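/- Let $\Gamma_5=\mathbb Z_2*\mathbb Z_2*\mathbb Z_2*\mathbb Z_2*\mathbb Z_2$ with free generators $a,b,c,d,e$ of order two, and let $T_5$ be the infinite $5$-regular tree with its proper edge colouring by $a,b,c,d,e$ and a base vertex $p$. For $l\in\{b,c\}$, the $(2^n,l,a)$-path from a vertex $x$ is the path of length $2^n$ in $T_5$ from $x$ with edge colours $l,a,l,a,\dots,l,a$. A code is a sequence $C=(a_n)_{n\ge1}$ with $a_n\in\{b,c\}$; let $\overline{b}=c$ and $\overline{c}=b$. Put $x_0=p$ and, for $n\ge 1$, let $x_n$ be the end of the $(2^n,\overline{a_n},a)$-path from $x_{n-1}$. For every $n\ge 1$ recolour the last edge of the $(2^n,a_n,a)$-path from $x_{n-1}$ by $D$. Let $S_C$ be the $\{a,b,c,d,e\}$-coloured tree obtained by replacing each $D$-coloured edge $(x,y)$ by a path $x,p_x,p_y,y$, with two new vertices $p_x,p_y$, whose edges are coloured $a,b,a$ in this order. The group $\Gamma_5$ acts on the vertex set $V(S_C)$: a generator moves a vertex along the edge of its colour if there is one at that vertex, and fixes the vertex otherwise. Write $p_C\in V(S_C)$ for the vertex $p$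 and $\mathrm{Stab}_{S_C}(p_C)\subset\Gamma_5$ for its stabilizer. An action of a countable group $\Gamma$ on a countable set $X$ is amenable if there are finite non-empty sets $F_n\subset X$, $n\ge 1$ (a Følner sequence), such that $\lim_{n\to\infty}|gF_n\cup F_n|/|F_n|=1$ for every $g\in\Gamma$. A countable group is amenable if its left action on itself is amenable. **Proposition.** Let $C\neq C'$ be two codes. Then there exist finitely generated non-amenable subgroups $H\subset \mathrm{Stab}_{S_C}(p_C)$ such that no finite non-empty subset of $V(S_{C'})$ is invariant under $H$. For every such subgroup $H$, the restricted action of $H$ on $V(S_{C'})$ is non-amenable. -/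

import Mathlib

open scoped Pointwise Topology
open Filter

noncomputable section

namespace CodeTree

/-- The five letters naming the standard generators of the free product of five copies
of the group of order two. -/
inductive Letter where
  | a | b | c | d | e
  deriving DecidableEq

/-- The free product of five cyclic groups of order two. -/
abbrev Gam5 : Type := Monoid.CoprodI (fun _ : Letter => Multiplicative (ZMod 2))

/-- The free generator of order two with name `i`. -/
def gen (i : Letter) : Gam5 :=
  Monoid.CoprodI.of (M := fun _ : Letter => Multiplicative (ZMod 2)) (i := i)
    (Multiplicative.ofAdd 1)

theorem gen_mul_self (i : Letter) : gen i * gen i = 1 := by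
  unfold gen
  rw [← map_mul, ← ofAdd_add]
  have h : (1 : ZMod 2) + 1 = 0 := by decide
  rw [h, ofAdd_zero, map_one]

theorem gen_ne_one (i : Letter) : gen i ≠ 1 := by
  unfold gen
  intro h
  rw [← map_one (Monoid.CoprodI.of (M := fun _ : Letter => Multiplicative (ZMod 2)) (i := i))] at h
  exact absurd (Monoid.CoprodI.of_injective i h) (by decide)

theorem gen_injective {i j : Letter} (h : gen i = gen j) : i = j := by
  classical
  by_contra hij
  have h2 := congrArg (Monoid.CoprodI.lift (N := Multiplicative (ZMod 2))
    (fun k : Letter => if k = i then MonoidHom.id _ else 1)) h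
  unfold gen at h2
  rw [Monoid.CoprodI.lift_of, Monoid.CoprodI.lift_of, if_pos rfl, if_neg (Ne.symm hij)] at h2
  exact absurd h2 (by decide)

/-- A simple graph on `V` with a proper edge colouring by `κ`. `Adj i x y` means that `x` and `y`
are joined by an edge of colour `i`; every edge has one colour, and different edges at a vertex
have different colours. -/
structure ColoredGraph (κ V : Type) where
  Adj : κ → V → V → Prop
  symm : ∀ {i x y}, Adj i x y → Adj i y x
  loopless : ∀ {i x}, ¬ Adj i x x
  color_unique : ∀ {i j x y}, Adj i x y → Adj j x y → i = j
  proper : ∀ {i x y z}, Adj i x y → Adj i x z → y = z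

namespace ColoredGraph

variable {κ V : Type}

open Classical in
/-- The other end of the `i`-coloured edge at `x` if there is such an edge, and `x` otherwise. -/
def step (G : ColoredGraph κ V) (i : κ) (x : V) : V :=
  if h : ∃ y, G.Adj i x y then h.choose else x

theorem step_of_adj (G : ColoredGraph κ V) {i : κ} {x y : V} (h : G.Adj i x y) :
    G.step i x = y := by
  have hex : ∃ y, G.Adj i x y := ⟨y, h⟩
  unfold step
  rw [dif_pos hex]
  exact G.proper hex.choose_spec h

theorem step_of_not (G : ColoredGraph κ V) {i : κ} {x : V} (h : ¬ ∃ y, G.Adj i x y) :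
    G.step i x = x := by
  unfold step
  rw [dif_neg h]

theorem step_step (G : ColoredGraph κ V) (i : κ) (x : V) : G.step i (G.step i x) = x := by
  by_cases h : ∃ y, G.Adj i x y
  · obtain ⟨y, hy⟩ := h
    rw [G.step_of_adj hy, G.step_of_adj (G.symm hy)]
  · rw [G.step_of_not h, G.step_of_not h]

/-- The permutation of the vertices by which the generator `i` acts. -/
def stepPerm (G : ColoredGraph κ V) (i : κ) : Equiv.Perm V where
  toFun := G.step i
  invFun := G.step i
  left_inv := G.step_step i
  right_inv := G.step_step i

theorem stepPerm_mul_self (G : ColoredGraph κ V) (i : κ) : G.stepPerm i * G.stepPerm i = 1 :=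
  Equiv.ext (G.step_step i)

/-- The homomorphism from the group of order two to the permutations of the vertices that sends
the generator to `stepPerm i`. -/
def stepHom (G : ColoredGraph κ V) (i : κ) : Multiplicative (ZMod 2) →* Equiv.Perm V where
  toFun z := if z = 1 then 1 else G.stepPerm i
  map_one' := if_pos rfl
  map_mul' := by
    have key : ∀ z : Multiplicative (ZMod 2), z = 1 ∨ z = Multiplicative.ofAdd 1 := by decide
    have h1 : (Multiplicative.ofAdd 1 : Multiplicative (ZMod 2)) ≠ 1 := by decide
    have h2 : (Multiplicative.ofAdd 1 : Multiplicative (ZMod 2)) * Multiplicative.ofAdd 1 = 1 := by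
      decide
    intro x y
    rcases key x with rfl | rfl <;> rcases key y with rfl | rfl
    · simp
    · simp
    · simp
    · rw [h2, if_pos rfl, if_neg h1, stepPerm_mul_self]

/-- The action on the vertices of a graph coloured by the five letters: the generator `i` moves
every vertex along its `i`-coloured edge, and fixes the vertices without such an edge. -/
def actionHom (G : ColoredGraph Letter V) : Gam5 →* Equiv.Perm V :=
  Monoid.CoprodI.lift G.stepHom

theorem actionHom_gen (G : ColoredGraph Letter V) (i : Letter) (x : V) :
    G.actionHom (gen i) x = G.step i x := by
  have h2 : G.stepHom i (Multiplicative.ofAdd 1) = G.stepPerm i := by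
    simp [stepHom]
  unfold actionHom gen
  rw [Monoid.CoprodI.lift_of, h2]
  rfl

/-- Recolouring by the new colour `D` (which is `none`) of those edges of colour `a` that are
in `M`. The other edges keep their colour. -/
def recolor (G : ColoredGraph Letter V) (M : Set (Sym2 V)) : ColoredGraph (Option Letter) V where
  Adj i x y := match i with
    | none => G.Adj .a x y ∧ s(x, y) ∈ M
    | some i => G.Adj i x y ∧ ¬ (i = .a ∧ s(x, y) ∈ M)
  symm {i x y} h := by
    cases i with
    | none => exact ⟨G.symm h.1, Sym2.eq_swap (a := x) (b := y) ▸ h.2⟩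
    | some i => exact ⟨G.symm h.1, Sym2.eq_swap (a := x) (b := y) ▸ h.2⟩
  loopless {i x} h := by
    cases i with
    | none => exact G.loopless h.1
    | some i => exact G.loopless h.1
  color_unique {i j x y} h h' := by
    cases i with
    | none =>
      cases j with
      | none => rfl
      | some j => exact absurd ⟨(G.color_unique h.1 h'.1).symm, h.2⟩ h'.2
    | some i =>
      cases j with
      | none => exact absurd ⟨G.color_unique h.1 h'.1, h'.2⟩ h.2
      | some j => exact congrArg some (G.color_unique h.1 h'.1)
  proper {i x y z} h h' := by
    cases i with
    | none => exact G.proper h.1 h'.1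
    | some i => exact G.proper h.1 h'.1

/-- A colouring by `a, b, c, d, e, D` is good if an edge adjacent to an edge of colour `D` never
has colour `a`. -/
def Good (T : ColoredGraph (Option Letter) V) : Prop :=
  ∀ x y z, T.Adj none x y → ¬ T.Adj (some .a) x z

theorem recolor_good (G : ColoredGraph Letter V) (M : Set (Sym2 V)) : (G.recolor M).Good := by
  intro x y z h h'
  have hyz : y = z := G.proper h.1 h'.1
  subst hyz
  exact h'.2 ⟨rfl, h.2⟩

/-- The vertices at which there is an edge of colour `D`. There is one new vertex for each of
them in the decorated graph (so two for each edge of colour `D`). -/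
abbrev DVertex (T : ColoredGraph (Option Letter) V) : Type := {x : V // ∃ y, T.Adj none x y}

/-- Every edge between `x` and `y` of colour `D` is replaced by a path `x, x', y', y` with edges
of colours `a`, `b`, `a`, where `x' = Sum.inr x` and `y' = Sum.inr y` are new vertices. All other
edges are kept. -/
def decorate (T : ColoredGraph (Option Letter) V) (hT : T.Good) :
    ColoredGraph Letter (V ⊕ T.DVertex) where
  Adj i p q := match p, q with
    | .inl x, .inl y => T.Adj (some i) x y
    | .inl x, .inr y' => i = .a ∧ x = y'.1
    | .inr x', .inl y => i = .a ∧ x'.1 = y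
    | .inr x', .inr y' => i = .b ∧ T.Adj none x'.1 y'.1
  symm {i p q} h := by
    rcases p with x | x <;> rcases q with y | y
    · exact T.symm h
    · exact ⟨h.1, h.2.symm⟩
    · exact ⟨h.1, h.2.symm⟩
    · exact ⟨h.1, T.symm h.2⟩
  loopless {i p} h := by
    rcases p with x | x
    · exact T.loopless h
    · exact T.loopless h.2
  color_unique {i j p q} h h' := by
    rcases p with x | x <;> rcases q with y | y
    · exact Option.some.inj (T.color_unique h h')
    · exact h.1.trans h'.1.symm
    · exact h.1.trans h'.1.symm
    · exact h.1.trans h'.1.symm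
  proper {i p q r} h h' := by
    rcases p with x | x <;> rcases q with y | y <;> rcases r with z | z
    · exact congrArg _ (T.proper h h')
    · obtain ⟨w, hw⟩ := z.2
      obtain ⟨rfl, rfl⟩ := h'
      exact absurd h (hT _ _ _ hw)
    · obtain ⟨w, hw⟩ := y.2
      obtain ⟨rfl, rfl⟩ := h
      exact absurd h' (hT _ _ _ hw)
    · exact congrArg _ (Subtype.ext (h.2.symm.trans h'.2))
    · exact congrArg _ (h.2.symm.trans h'.2)
    · exact absurd (h.1.symm.trans h'.1) (by decide)
    · exact absurd (h.1.symm.trans h'.1) (by decide)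
    · exact congrArg _ (Subtype.ext (T.proper h.2 h'.2))

end ColoredGraph

/-- The infinite tree of vertex degrees five with its proper edge colouring by `a, b, c, d, e`,
as the Cayley graph of the free product: the `i`-coloured edge at `x` leads to `gen i * x`. -/
def T5 : ColoredGraph Letter Gam5 where
  Adj i x y := y = gen i * x
  symm {i x y} h := by rw [h, ← mul_assoc, gen_mul_self, one_mul]
  loopless {i x} h := gen_ne_one i (mul_eq_right.mp h.symm)
  color_unique h h' := gen_injective (mul_right_cancel (h.symm.trans h'))
  proper h h' := h.trans h'.symm

/-- A code is an infinite sequence of letters `b` and `c`. It is indexed from `0`, so that `C n`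
is the letter that is used in step `n + 1` of the construction. -/
abbrev Code : Type := ℕ → {l : Letter // l = .b ∨ l = .c}

/-- The other one of the two letters `b` and `c`. -/
def other (l : Letter) : Letter := if l = .b then .c else .b

/-- The vertex number `k` on the path in `T5` that starts from `x` and has edges of colours
`l, a, l, a, …`. -/
def pathVertex (x : Gam5) (l : Letter) : ℕ → Gam5
  | 0 => x
  | k + 1 => T5.step (if Even k then l else .a) (pathVertex x l k)

/-- The vertices `x_0 = p, x_1, x_2, …`: the vertex `x_{n+1}` is the end of the path of length
`2 ^ (n + 1)` with colours `l, a, l, a, …, l, a` from `x_n`, where `l` is the letter different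
from `C n`. -/
def spine (C : Code) : ℕ → Gam5
  | 0 => 1
  | n + 1 => pathVertex (spine C n) (other (C n)) (2 ^ (n + 1))

/-- The edges that are recoloured by `D`: for each `n`, the last edge of the path of length
`2 ^ (n + 1)` with colours `l, a, l, a, …, l, a` from `x_n`, where `l = C n`. -/
def dEdges (C : Code) : Set (Sym2 Gam5) :=
  {s | ∃ n : ℕ, s = s(pathVertex (spine C n) (C n) (2 ^ (n + 1) - 1),
    pathVertex (spine C n) (C n) (2 ^ (n + 1)))}

/-- The good `(a, b, c, d, e, D)`-tree of the code. -/
def treeT (C : Code) : ColoredGraph (Option Letter) Gam5 := T5.recolor (dEdges C)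

theorem treeT_good (C : Code) : (treeT C).Good := T5.recolor_good (dEdges C)

/-- The vertex set of the tree `treeS C`. -/
def VertS (C : Code) : Type := Gam5 ⊕ (treeT C).DVertex

/-- The `(a, b, c, d, e)`-tree of the code. -/
def treeS (C : Code) : ColoredGraph Letter (VertS C) := (treeT C).decorate (treeT_good C)

/-- The action of the free product on the vertices of `treeS C`. -/
instance instMulActionVertS (C : Code) : MulAction Gam5 (VertS C) :=
  MulAction.compHom (VertS C) (treeS C).actionHom

/-- The base vertex of `treeS C`. -/
def baseVertex (C : Code) : VertS C := Sum.inl 1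

open Classical in
/-- Amenability of an action (of a countable group on a countable set): there is a sequence of
finite non-empty sets `F n` with `|g F n ∪ F n| / |F n| → 1` for every group element `g`. -/
def AmenableAction (G X : Type) [Group G] [MulAction G X] : Prop :=
  ∃ F : ℕ → Finset X, (∀ n, (F n).Nonempty) ∧
    ∀ g : G, Tendsto (fun n => ((((F n).image (g • ·)) ∪ F n).card : ℝ) / ((F n).card : ℝ))
      atTop (𝓝 1)

/-- Amenability of a countable group: its left action on itself is amenable. -/
def AmenableGroup (G : Type) [Group G] : Prop := AmenableAction G G

/-- `H` is a finitely generated non-amenable subgroup of the stabilizer of the base vertex of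
`treeS C`, and no finite non-empty set of vertices of `treeS C'` is invariant under `H`. -/
structure IsSeparating (C C' : Code) (H : Subgroup Gam5) : Prop where
  le_stabilizer : H ≤ MulAction.stabilizer Gam5 (baseVertex C)
  fg : H.FG
  not_amenable : ¬ AmenableGroup H
  no_invariant : ∀ F : Finset (VertS C'), F.Nonempty → ¬ ∀ h ∈ H, ∀ v ∈ F, h • v ∈ F

end CodeTree

end

/-!
Elements of `Gam5` are written as reduced words whose first letter is the first to act. Three
ideas carry the proof.

*Paradoxical decomposition.* A finite subset of the free product cannot be almost invariant under
left multiplication by three generators `c`, `d`, `e` (`not_almost_invariant`). This gives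
non-amenability of every subgroup that contains conjugates of `c`, `d`, `e` by one element, and
it shows that a finite set of vertices which is invariant under these conjugates is carried by the
conjugating element into the set of new vertices (`exists_smul_eq_mid`).

*Existence.* Let the codes differ at `k`. For `n = k, k + 1` let `t n` lead from the base vertex of
`treeS C` to the new vertex next to the `D`-edge number `n`. The generators `c`, `d`, `e` fix that
vertex, so their conjugates by `t k` and `t (k + 1)` generate a subgroup of the stabilizer. If a
vertex `v` lay in a finite invariant set in `treeS C'`, then `t k` and `t (k + 1)` would both move
`v` to new vertices, and the word that leads from the `D`-edge `k` to the `D`-edge `k + 1` of `C`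
would lead from one `D`-edge of `C'` to another. Such words alternate between `a` and other letters
with a single fault, and the place of the fault and the first letter determine the number of the
`D`-edge and the letter of the code there (`exists_connecting_word`, `eq_of_fault_prefix`). This
contradicts `C k ≠ C' k` (`not_isD_of_code_ne`).

*Non-amenability of the action.* Suppose that `H` has no finite invariant sets and acts amenably
on the vertices of `treeS C'`. All orbits of `H` are infinite and the `D`-edges are further and
further apart, so a Følner sequence has density zero within any bounded distance from the `D`-edges
(`eventually_card_filter_range_le`). Elsewhere the action looks like left multiplication
(`nearD_smul_ne`). Hence the Følner sequence restricts to one for the free action of `H` on `Gam5`,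
and `H` is amenable (`AmenableAction.amenableGroup_of_free`).
-/

namespace CodeTree

/-! ### Reduced words -/

theorem gen_inv (i : Letter) : (gen i)⁻¹ = gen i :=
  inv_eq_of_mul_eq_one_left (gen_mul_self i)

/-- Induction on the word length: every element arises from `1` by multiplications with
generators from the left. -/
theorem gam5_induction {P : Gam5 → Prop} (x : Gam5) (one : P 1)
    (gen_mul : ∀ i x, P x → P (gen i * x)) : P x := by
  induction x using Monoid.CoprodI.induction_left with
  | one => exact one
  | @mul i m x ih =>
    have key : ∀ z : Multiplicative (ZMod 2), z = 1 ∨ z = Multiplicative.ofAdd 1 := by decide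
    rcases key m with rfl | rfl
    · rwa [map_one, one_mul]
    · exact gen_mul i x ih

/-- The group element that is spelled by a list of letters. The first letter of the list is the
first one to act, so it is the rightmost factor of the product. -/
def wordProd (w : List Letter) : Gam5 := (w.reverse.map gen).prod

@[simp] theorem wordProd_nil : wordProd [] = 1 := rfl

@[simp] theorem wordProd_singleton (i : Letter) : wordProd [i] = gen i := by
  simp [wordProd]

theorem wordProd_append (v w : List Letter) : wordProd (v ++ w) = wordProd w * wordProd v := by
  simp [wordProd]

theorem wordProd_concat (w : List Letter) (i : Letter) :
    wordProd (w ++ [i]) = gen i * wordProd w := by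
  rw [wordProd_append, wordProd_singleton]

theorem wordProd_reverse (w : List Letter) : wordProd w.reverse = (wordProd w)⁻¹ := by
  induction w with
  | nil => simp
  | cons i w ih =>
    have h : i :: w = [i] ++ w := rfl
    rw [List.reverse_cons, wordProd_concat, ih, h, wordProd_append, wordProd_singleton,
      mul_inv_rev, gen_inv]

/-- A word is reduced if no two adjacent letters are equal. -/
abbrev Reduced (w : List Letter) : Prop := w.IsChain (· ≠ ·)

theorem Reduced.reverse {w : List Letter} (h : Reduced w) : Reduced w.reverse := by
  rw [Reduced, List.isChain_reverse]
  exact h.imp fun _ _ hab => hab.symm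

theorem Reduced.concat {w : List Letter} (h : Reduced w) {i : Letter}
    (hi : w.getLast? ≠ some i) : Reduced (w ++ [i]) := by
  refine List.IsChain.append h (by simp) ?_
  intro x hx y hy hxy
  simp only [List.head?_cons, Option.mem_def, Option.some.injEq] at hy
  subst hy
  subst hxy
  exact hi hx

theorem Reduced.prefix {v w : List Letter} (h : Reduced w) (hv : v <+: w) : Reduced v :=
  List.IsChain.prefix h hv

/-- Uniqueness of the normal form in the free product. -/
theorem Reduced.wordProd_inj {v w : List Letter} (hv : Reduced v) (hw : Reduced w)
    (h : wordProd v = wordProd w) : v = w := by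
  have hne : (Multiplicative.ofAdd 1 : Multiplicative (ZMod 2)) ≠ 1 := by decide
  let f : Letter → (Σ _ : Letter, Multiplicative (ZMod 2)) := fun i => ⟨i, Multiplicative.ofAdd 1⟩
  let toW : ∀ u : List Letter, Reduced u →
      Monoid.CoprodI.Word (fun _ : Letter => Multiplicative (ZMod 2)) := fun u hu =>
    { toList := u.reverse.map f
      ne_one := by
        intro l hl
        obtain ⟨i, -, rfl⟩ := List.mem_map.mp hl
        exact hne
      chain_ne := by
        rw [List.isChain_map]
        exact hu.reverse }
  have hprod : ∀ u hu, (toW u hu).prod = wordProd u := by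
    intro u hu
    simp only [Monoid.CoprodI.Word.prod, wordProd, toW, List.map_map]
    rfl
  have h1 : toW v hv = toW w hw := by
    classical
    apply (Monoid.CoprodI.Word.equiv (M := fun _ : Letter => Multiplicative (ZMod 2))).symm.injective
    exact (hprod v hv).trans (h.trans (hprod w hw).symm)
  have h2 : v.reverse.map f = w.reverse.map f := congrArg Monoid.CoprodI.Word.toList h1
  have hf : Function.Injective f := fun i j hij => congrArg Sigma.fst hij
  exact List.reverse_injective (List.map_injective_iff.mpr hf h2)

theorem exists_reduced (x : Gam5) : ∃ w, Reduced w ∧ wordProd w = x := by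
  induction x using gam5_induction with
  | one => exact ⟨[], by simp, rfl⟩
  | gen_mul i x ih =>
    obtain ⟨w, hw, rfl⟩ := ih
    by_cases hi : w.getLast? = some i
    · obtain ⟨v, rfl⟩ := List.getLast?_eq_some_iff.mp hi
      exact ⟨v, hw.prefix (List.prefix_append _ _), by
        rw [wordProd_concat, ← mul_assoc, gen_mul_self, one_mul]⟩
    · exact ⟨w ++ [i], hw.concat hi, wordProd_concat w i⟩

/-- The reduced word that spells a group element. -/
noncomputable def red (x : Gam5) : List Letter := (exists_reduced x).choose

theorem red_reduced (x : Gam5) : Reduced (red x) := (exists_reduced x).choose_spec.1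

theorem wordProd_red (x : Gam5) : wordProd (red x) = x := (exists_reduced x).choose_spec.2

theorem Reduced.red_wordProd {w : List Letter} (h : Reduced w) : red (wordProd w) = w :=
  (red_reduced _).wordProd_inj h (wordProd_red _)

theorem red_gen_mul {i : Letter} {x : Gam5} (h : (red x).getLast? ≠ some i) :
    red (gen i * x) = red x ++ [i] := by
  have h1 := ((red_reduced x).concat h).red_wordProd
  rwa [wordProd_concat, wordProd_red] at h1

theorem length_red_gen_mul_le (i : Letter) (x : Gam5) :
    (red (gen i * x)).length ≤ (red x).length + 1 := by
  by_cases h : (red x).getLast? = some i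
  · obtain ⟨v, hv⟩ := List.getLast?_eq_some_iff.mp h
    have hx : x = wordProd (v ++ [i]) := by rw [← hv, wordProd_red]
    have hvr : Reduced v := (hv ▸ red_reduced x).prefix (List.prefix_append _ _)
    have h1 : gen i * x = wordProd v := by
      rw [hx, wordProd_concat, ← mul_assoc, gen_mul_self, one_mul]
    rw [h1, hvr.red_wordProd, hv]
    simp
    omega
  · rw [red_gen_mul h]
    simp

instance : Countable Gam5 := by
  have : Countable Letter := by
    refine ⟨⟨fun l => match l with | .a => 0 | .b => 1 | .c => 2 | .d => 3 | .e => 4, ?_⟩⟩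
    intro x y h
    cases x <;> cases y <;> simp_all
  exact Function.Surjective.countable (f := wordProd) fun x => ⟨red x, wordProd_red x⟩

/-! ### The paradoxical decomposition of the free product -/

/-- A finite set cannot be almost invariant under three of the generators. For a
generator `i`, multiplication by `gen i` moves every element whose reduced word does not end in
`i` to one whose word does. So nearly half of an almost invariant set would consist of
words that end in `i`, for each of the three letters `i`. -/
theorem not_almost_invariant [DecidableEq Gam5] (E : Finset Gam5)
    (h : ∀ i : Letter, i = .c ∨ i = .d ∨ i = .e →
      3 * (E.image (gen i * ·) ∪ E).card < 4 * E.card) : False := by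
  let P : Letter → Finset Gam5 := fun i => E.filter fun x => (red x).getLast? = some i
  have key : ∀ i : Letter, i = .c ∨ i = .d ∨ i = .e → E.card < 3 * (P i).card := by
    intro i hi
    let Q := E.filter fun x => ¬ (red x).getLast? = some i
    have hPQ : (P i).card + Q.card = E.card := Finset.card_filter_add_card_filter_not _
    have hdis : Disjoint (Q.image (gen i * ·)) Q := by
      rw [Finset.disjoint_left]
      intro y hy hy'
      obtain ⟨x, hx, rfl⟩ := Finset.mem_image.mp hy
      refine (Finset.mem_filter.mp hy').2 ?_
      rw [red_gen_mul (Finset.mem_filter.mp hx).2]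
      simp
    have hsub : Q.image (gen i * ·) ∪ Q ⊆ E.image (gen i * ·) ∪ E :=
      Finset.union_subset_union (Finset.image_subset_image (Finset.filter_subset _ _))
        (Finset.filter_subset _ _)
    have h1 := Finset.card_le_card hsub
    rw [Finset.card_union_of_disjoint hdis,
      Finset.card_image_of_injective _ (mul_right_injective (gen i))] at h1
    have h2 := h i hi
    omega
  have hd : ∀ i j, i ≠ j → Disjoint (P i) (P j) := by
    intro i j hij
    rw [Finset.disjoint_left]
    intro x hx hx'
    exact hij (Option.some.inj ((Finset.mem_filter.mp hx).2.symm.trans (Finset.mem_filter.mp hx').2))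
  have h1 : (P .c ∪ P .d ∪ P .e).card ≤ E.card := Finset.card_le_card (by
    intro x hx
    simp only [Finset.mem_union] at hx
    rcases hx with (hx | hx) | hx <;> exact (Finset.mem_filter.mp hx).1)
  rw [Finset.card_union_of_disjoint (Finset.disjoint_union_left.mpr
    ⟨hd _ _ (by decide), hd _ _ (by decide)⟩),
    Finset.card_union_of_disjoint (hd _ _ (by decide))] at h1
  have hc := key .c (by simp)
  have hd' := key .d (by simp)
  have he := key .e (by simp)
  omega

/-! ### Følner sets -/

section Folner

variable {G X : Type} [Group G] [MulAction G X]

theorem card_image_smul_union [DecidableEq X] (g : G) (E : Finset X) :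
    (E.image (g • ·) ∪ E).card = (E.image (g • ·) \ E).card + E.card := by
  rw [← Finset.card_sdiff_add_card]

/-- The defining property of Følner sets in terms of the differences `gF \ F`. -/
theorem AmenableAction.exists_sdiff [dX : DecidableEq X] (h : AmenableAction G X) :
    ∃ F : ℕ → Finset X, (∀ n, (F n).Nonempty) ∧ ∀ (g : G) (ε : ℝ), 0 < ε →
      ∀ᶠ n in atTop, (((F n).image (g • ·) \ F n).card : ℝ) ≤ ε * (F n).card := by
  obtain rfl : dX = fun a b => Classical.propDecidable (a = b) := Subsingleton.elim _ _
  classical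
  obtain ⟨F, hne, hF⟩ := h
  refine ⟨F, hne, fun g ε hε => ?_⟩
  filter_upwards [(hF g).eventually_lt_const (show (1 : ℝ) < 1 + ε by linarith)] with n hn
  have hpos : (0 : ℝ) < (F n).card := by exact_mod_cast (hne n).card_pos
  rw [div_lt_iff₀ hpos] at hn
  have h1 := card_image_smul_union g (F n)
  have h2 : (((F n).image (g • ·) ∪ F n).card : ℝ) =
    ((F n).image (g • ·) \ F n).card + (F n).card := by
      exact_mod_cast h1
  linarith

/-- For a countable group, one almost invariant set for each finite set of group elements and each
bound is enough for amenability. -/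
theorem amenableAction_of_finite [dX : DecidableEq X] [Countable G]
    (h : ∀ (S : Finset G) (ε : ℝ), 0 < ε → ∃ F : Finset X, F.Nonempty ∧
      ∀ g ∈ S, ((F.image (g • ·) \ F).card : ℝ) ≤ ε * F.card) : AmenableAction G X := by
  obtain rfl : dX = fun a b => Classical.propDecidable (a = b) := Subsingleton.elim _ _
  classical
  obtain ⟨φ, hφ⟩ := exists_surjective_nat G
  choose F hne hF using fun n : ℕ =>
    h ((Finset.range (n + 1)).image φ) (1 / ((n : ℝ) + 1)) (by positivity)
  refine ⟨F, hne, fun g => ?_⟩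
  obtain ⟨m, rfl⟩ := hφ g
  have hlim : Tendsto (fun n : ℕ => 1 + 1 / ((n : ℝ) + 1)) atTop (𝓝 1) := by
    simpa using (tendsto_one_div_add_atTop_nhds_zero_nat (𝕜 := ℝ)).const_add 1
  refine tendsto_of_tendsto_of_tendsto_of_le_of_le' tendsto_const_nhds hlim ?_ ?_
  · refine Eventually.of_forall fun n => ?_
    have hpos : (0 : ℝ) < (F n).card := by exact_mod_cast (hne n).card_pos
    rw [le_div_iff₀ hpos, one_mul]
    exact_mod_cast Finset.card_le_card Finset.subset_union_right
  · filter_upwards [eventually_ge_atTop m] with n hn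
    have hpos : (0 : ℝ) < (F n).card := by exact_mod_cast (hne n).card_pos
    have h1 := hF n (φ m) (Finset.mem_image_of_mem φ (Finset.mem_range.mpr (by omega)))
    have h2 : (((F n).image (φ m • ·) ∪ F n).card : ℝ) =
      ((F n).image (φ m • ·) \ F n).card + (F n).card := by
        exact_mod_cast card_image_smul_union (φ m) (F n)
    rw [div_le_iff₀ hpos]
    linarith

/-- A countable group with an amenable free action is amenable: an almost invariant set is
a disjoint union of its intersections with the orbits, and by averaging one of these, seen as a
subset of the group, is almost invariant. -/
theorem AmenableAction.amenableGroup_of_free [Countable G] (h : AmenableAction G X)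
    (hfree : ∀ (g : G) (x : X), g • x = x → g = 1) : AmenableGroup G := by
  classical
  obtain ⟨F, hne, hF⟩ := h.exists_sdiff
  refine amenableAction_of_finite fun S ε hε => ?_
  have hev : ∀ᶠ n in atTop, ∀ g ∈ S,
      (((F n).image (g • ·) \ F n).card : ℝ) ≤ ε / (S.card + 1) * (F n).card :=
    (Finset.eventually_all S).mpr fun g _ => hF g _ (by positivity)
  obtain ⟨n, hn⟩ := hev.exists
  let π : X → Quotient (MulAction.orbitRel G X) := fun x => Quotient.mk _ x
  have hκ : ∀ x : X, ∃ g : G, g • (π x).out = x := fun x => by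
    have h1 : (MulAction.orbitRel G X).r x (π x).out :=
      Setoid.symm' _ (Quotient.mk_out (s := MulAction.orbitRel G X) x)
    exact h1
  choose κ hκ using hκ
  have hπ : ∀ (g : G) (x : X), π (g • x) = π x := fun g x =>
    Quotient.sound (show (MulAction.orbitRel G X).r (g • x) x from ⟨g, rfl⟩)
  have hκs : ∀ (g : G) (x : X), κ (g • x) = g * κ x := by
    intro g x
    have h1 := hκ (g • x)
    rw [hπ] at h1
    have h2 : ((g * κ x)⁻¹ * κ (g • x)) • (π x).out = (π x).out := by
      rw [mul_smul, h1, inv_smul_eq_iff, mul_smul, hκ]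
    have h3 := hfree _ _ h2
    exact (inv_mul_eq_one.mp h3).symm
  have hinj : ∀ x y, π x = π y → κ x = κ y → x = y := by
    intro x y h1 h2
    rw [← hκ x, ← hκ y, h1, h2]
  let E : Quotient (MulAction.orbitRel G X) → Finset G := fun q =>
    ((F n).filter fun x => π x = q).image κ
  have hE : ∀ q, (E q).card = ((F n).filter fun x => π x = q).card := by
    intro q
    refine Finset.card_image_of_injOn ?_
    intro x hx y hy hxy
    simp only [Finset.coe_filter, Set.mem_ofPred_eq] at hx hy
    exact hinj x y (hx.2.trans hy.2.symm) hxy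
  have hEd : ∀ q (g : G), ((E q).image (g • ·) \ E q).card ≤
      (((F n).image (g • ·) \ F n).filter fun x => π x = q).card := by
    intro q g
    refine (Finset.card_le_card ?_).trans (Finset.card_image_le (f := κ))
    intro y hy
    obtain ⟨hy1, hy2⟩ := Finset.mem_sdiff.mp hy
    obtain ⟨z, hz, rfl⟩ := Finset.mem_image.mp hy1
    obtain ⟨x, hx, rfl⟩ := Finset.mem_image.mp hz
    obtain ⟨hx1, hx2⟩ := Finset.mem_filter.mp hx
    refine Finset.mem_image.mpr ⟨g • x, ?_, hκs g x⟩
    refine Finset.mem_filter.mpr ⟨Finset.mem_sdiff.mpr ⟨Finset.mem_image_of_mem _ hx1, ?_⟩,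
      (hπ g x).trans hx2⟩
    intro hmem
    refine hy2 (Finset.mem_image.mpr ⟨g • x, Finset.mem_filter.mpr ⟨hmem, (hπ g x).trans hx2⟩, ?_⟩)
    exact hκs g x
  let T := (F n).image π
  have hT : T.Nonempty := (hne n).image π
  have hsumE : ∑ q ∈ T, (E q).card = (F n).card := by
    rw [Finset.card_eq_sum_card_fiberwise (f := π) (t := T)
      (fun x hx => Finset.mem_image_of_mem π hx)]
    exact Finset.sum_congr rfl fun q _ => hE q
  have hsumD : ∀ g : G, ∑ q ∈ T, ((E q).image (g • ·) \ E q).card ≤ ((F n).image (g • ·) \ F n).card := by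
    intro g
    refine (Finset.sum_le_sum fun q _ => hEd q g).trans ?_
    rw [← Finset.card_eq_sum_card_fiberwise (f := π) (t := T)]
    intro x hx
    obtain ⟨y, hy, rfl⟩ := Finset.mem_image.mp (Finset.mem_sdiff.mp hx).1
    rw [hπ]
    exact Finset.mem_coe.mpr (Finset.mem_image_of_mem π hy)
  have hle : ∑ q ∈ T, (∑ g ∈ S, (((E q).image (g • ·) \ E q).card : ℝ)) ≤
      ∑ q ∈ T, ε * ((E q).card : ℝ) := by
    rw [Finset.sum_comm, ← Finset.mul_sum]
    have h1 : ∀ g ∈ S, ∑ q ∈ T, (((E q).image (g • ·) \ E q).card : ℝ) ≤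
        ε / (S.card + 1) * (F n).card := fun g hg =>
      le_trans (by exact_mod_cast hsumD g) (hn g hg)
    refine (Finset.sum_le_sum h1).trans ?_
    have h2 : (∑ q ∈ T, ((E q).card : ℝ)) = (F n).card := by exact_mod_cast hsumE
    rw [h2, Finset.sum_const, nsmul_eq_mul, ← mul_assoc]
    refine mul_le_mul_of_nonneg_right ?_ (Nat.cast_nonneg _)
    rw [← mul_div_assoc, div_le_iff₀ (by positivity)]
    nlinarith
  obtain ⟨q, hq, hqle⟩ := Finset.exists_le_of_sum_le hT hle
  refine ⟨E q, ?_, fun g hg => le_trans ?_ hqle⟩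
  · obtain ⟨x, hx, rfl⟩ := Finset.mem_image.mp hq
    exact ⟨κ x, Finset.mem_image_of_mem κ (Finset.mem_filter.mpr ⟨hx, rfl⟩)⟩
  · exact Finset.single_le_sum (f := fun g => (((E q).image (g • ·) \ E q).card : ℝ))
      (fun _ _ => Nat.cast_nonneg _) hg

/-- If no finite non-empty set is invariant under a finitely generated group, then all
orbits grow at least linearly, at a rate that does not depend on the point. -/
theorem exists_finset_card_image_smul [DecidableEq X] (hfg : Group.FG G)
    (hinv : ∀ F : Finset X, F.Nonempty → ¬ ∀ (g : G), ∀ x ∈ F, g • x ∈ F) (r : ℕ) :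
    ∃ B : Finset G, ∀ x : X, r + 1 ≤ (B.image (· • x)).card := by
  classical
  obtain ⟨S, hS⟩ := hfg.out
  induction r with
  | zero => exact ⟨{1}, fun x => by simp⟩
  | succ r ih =>
    obtain ⟨B, hB⟩ := ih
    refine ⟨B ∪ Finset.image₂ (· * ·) S B, fun x => ?_⟩
    have hne : (B.image (· • x)).Nonempty := Finset.card_pos.mp (by have := hB x; omega)
    obtain ⟨s, hs, y, hy, hsy⟩ : ∃ s ∈ S, ∃ y ∈ B.image (· • x), s • y ∉ B.image (· • x) := by
      by_contra hcon
      push Not at hcon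
      refine hinv _ hne fun g => ?_
      -- On a finite set, an injection into itself is onto, so inverses preserve it too.
      have hg : g ∈ Subgroup.closure (S : Set G) := hS ▸ Subgroup.mem_top g
      induction hg using Subgroup.closure_induction with
      | mem s hs => exact hcon s hs
      | one => simp
      | mul g h _ _ hg hh => intro x hx; rw [mul_smul]; exact hg _ (hh x hx)
      | inv g _ hg =>
        have himg : (B.image (· • x)).image (g • ·) = B.image (· • x) := by
          refine Finset.eq_of_subset_of_card_le (Finset.image_subset_iff.mpr hg) ?_
          rw [Finset.card_image_of_injective _ (MulAction.injective g)]
        intro y hy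
        rw [← himg] at hy
        obtain ⟨z, hz, rfl⟩ := Finset.mem_image.mp hy
        simpa using hz
    have hss : B.image (· • x) ⊂ (B ∪ Finset.image₂ (· * ·) S B).image (· • x) := by
      refine Finset.ssubset_iff.mpr ⟨s • y, hsy, ?_⟩
      refine Finset.insert_subset ?_ (Finset.image_subset_image Finset.subset_union_left)
      obtain ⟨g, hg, rfl⟩ := Finset.mem_image.mp hy
      refine Finset.mem_image.mpr ⟨s * g, Finset.mem_union_right _
        (Finset.mem_image₂_of_mem hs hg), mul_smul _ _ _⟩
    have := Finset.card_lt_card hss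
    have := hB x
    omega

/-- Points with pairwise disjoint finite pieces of orbits of size `r + 1` fill at most the part
`2 / (r + 1)` of a sufficiently invariant set. -/
theorem card_le_of_disjoint_orbits [DecidableEq X] {B : Finset G} {r : ℕ}
    (hB : ∀ x : X, r + 1 ≤ (B.image (· • x)).card) {F T : Finset X} (hT : T ⊆ F)
    (hF : ∀ g ∈ B, ((F.image (g • ·) \ F).card : ℝ) ≤ 1 / (B.card + 1) * F.card)
    (hdis : ∀ x ∈ T, ∀ y ∈ T, x ≠ y → ∀ g ∈ B, ∀ h ∈ B, g • x ≠ h • y) :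
    ((r : ℝ) + 1) * T.card ≤ 2 * F.card := by
  have h1 : (T.biUnion fun x => B.image (· • x)).card = ∑ x ∈ T, (B.image (· • x)).card := by
    refine Finset.card_biUnion fun x hx y hy hxy => Finset.disjoint_left.mpr ?_
    intro z hz hz'
    obtain ⟨g, hg, rfl⟩ := Finset.mem_image.mp hz
    obtain ⟨h, hh, hgh⟩ := Finset.mem_image.mp hz'
    exact hdis x hx y hy hxy g hg h hh hgh.symm
  have h2 : (r + 1) * T.card ≤ (T.biUnion fun x => B.image (· • x)).card := by
    rw [h1, mul_comm, ← smul_eq_mul, ← Finset.sum_const]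
    exact Finset.sum_le_sum fun x _ => hB x
  have h3 : (T.biUnion fun x => B.image (· • x)) ⊆
      F ∪ B.biUnion fun g => F.image (g • ·) \ F := by
    intro z hz
    obtain ⟨x, hx, hz⟩ := Finset.mem_biUnion.mp hz
    obtain ⟨g, hg, rfl⟩ := Finset.mem_image.mp hz
    by_cases hgx : g • x ∈ F
    · exact Finset.mem_union_left _ hgx
    · exact Finset.mem_union_right _ (Finset.mem_biUnion.mpr ⟨g, hg, Finset.mem_sdiff.mpr
        ⟨Finset.mem_image_of_mem _ (hT hx), hgx⟩⟩)
  have h4 : (r + 1) * T.card ≤ F.card + ∑ g ∈ B, (F.image (g • ·) \ F).card :=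
    h2.trans ((Finset.card_le_card h3).trans ((Finset.card_union_le _ _).trans
      (Nat.add_le_add_left Finset.card_biUnion_le _)))
  have h5 : ∑ g ∈ B, ((F.image (g • ·) \ F).card : ℝ) ≤ F.card := by
    refine (Finset.sum_le_sum hF).trans ?_
    rw [Finset.sum_const, nsmul_eq_mul, ← mul_assoc]
    refine mul_le_of_le_one_left (Nat.cast_nonneg _) ?_
    rw [mul_one_div, div_le_one (by positivity)]
    linarith
  have h6 : ((r : ℝ) + 1) * T.card ≤ F.card + ∑ g ∈ B, ((F.image (g • ·) \ F).card : ℝ) := by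
    exact_mod_cast h4
  linarith

/-- A sequence whose translates by each fixed group element hardly meet it has density zero with
respect to Følner sets, if all orbits are infinite. -/
theorem eventually_card_filter_range_le [DecidableEq X] {F : ℕ → Finset X}
    (hne : ∀ n, (F n).Nonempty)
    (hF : ∀ (g : G) (ε : ℝ), 0 < ε →
      ∀ᶠ n in atTop, (((F n).image (g • ·) \ F n).card : ℝ) ≤ ε * (F n).card)
    (hB : ∀ r : ℕ, ∃ B : Finset G, ∀ x : X, r + 1 ≤ (B.image (· • x)).card)
    {p : ℕ → X} (hp : ∀ g : G, ∃ N, ∀ m ≥ N, ∀ n ≥ N, m ≠ n → g • p m ≠ p n)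
    [DecidablePred (· ∈ Set.range p)] {ε : ℝ} (hε : 0 < ε) :
    ∀ᶠ n in atTop, (((F n).filter (· ∈ Set.range p)).card : ℝ) ≤ ε * (F n).card := by
  classical
  have hev : ∀ B : Finset G, ∀ᶠ n in atTop, ∀ g ∈ B,
      (((F n).image (g • ·) \ F n).card : ℝ) ≤ 1 / (B.card + 1) * (F n).card := fun B =>
    (Finset.eventually_all B).mpr fun g _ => hF g _ (by positivity)
  obtain ⟨r, hr⟩ := exists_nat_gt (4 / ε)
  obtain ⟨B, hBr⟩ := hB r
  obtain ⟨N, hN⟩ : ∃ N, ∀ g ∈ B, ∀ h ∈ B, ∀ m ≥ N, ∀ n ≥ N, m ≠ n → g • p m ≠ h • p n := by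
    choose N hN using hp
    refine ⟨(B ×ˢ B).sup fun q => N (q.2⁻¹ * q.1), fun g hg h hh m hm n hn hmn heq => ?_⟩
    have hle : N (h⁻¹ * g) ≤ (B ×ˢ B).sup fun q => N (q.2⁻¹ * q.1) :=
      Finset.le_sup (f := fun q : G × G => N (q.2⁻¹ * q.1))
        (Finset.mem_product.mpr ⟨hg, hh⟩ : (g, h) ∈ B ×ˢ B)
    exact hN (h⁻¹ * g) m (hle.trans hm) n (hle.trans hn) hmn (by rw [mul_smul, heq, inv_smul_smul])
  obtain ⟨r', hr'⟩ := exists_nat_gt (4 * N / ε)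
  obtain ⟨B', hBr'⟩ := hB r'
  filter_upwards [hev B, hev B'] with n hn hn'
  -- The sets `F n` grow, so that the finitely many points before `N` do not matter.
  have hbig : ((r' : ℝ) + 1) ≤ 2 * (F n).card := by
    obtain ⟨x, hx⟩ := hne n
    have := card_le_of_disjoint_orbits hBr' (T := {x}) (Finset.singleton_subset_iff.mpr hx) hn' (by
      intro y hy z hz hyz
      exact absurd ((Finset.mem_singleton.mp hy).trans (Finset.mem_singleton.mp hz).symm) hyz)
    simpa using this
  let T := (F n).filter fun x => ∃ m ≥ N, p m = x
  have hT : ((r : ℝ) + 1) * T.card ≤ 2 * (F n).card := by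
    refine card_le_of_disjoint_orbits hBr (Finset.filter_subset _ _) hn ?_
    intro x hx y hy hxy g hg h hh
    obtain ⟨i, hi, rfl⟩ := (Finset.mem_filter.mp hx).2
    obtain ⟨j, hj, rfl⟩ := (Finset.mem_filter.mp hy).2
    exact hN g hg h hh i hi j hj fun hij => hxy (by rw [hij])
  have hsub : (F n).filter (· ∈ Set.range p) ⊆ T ∪ (Finset.range N).image p := by
    intro x hx
    obtain ⟨hx1, m, rfl⟩ := Finset.mem_filter.mp hx
    by_cases hm : N ≤ m
    · exact Finset.mem_union_left _ (Finset.mem_filter.mpr ⟨hx1, m, hm, rfl⟩)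
    · exact Finset.mem_union_right _ (Finset.mem_image_of_mem p (Finset.mem_range.mpr (by omega)))
  have hcard : ((F n).filter (· ∈ Set.range p)).card ≤ T.card + N :=
    (Finset.card_le_card hsub).trans ((Finset.card_union_le _ _).trans
      (Nat.add_le_add_left (Finset.card_image_le.trans_eq (Finset.card_range N)) _))
  have hcard' : (((F n).filter (· ∈ Set.range p)).card : ℝ) ≤ T.card + N := by exact_mod_cast hcard
  rw [div_lt_iff₀ hε] at hr hr'
  have hF0 : (0 : ℝ) ≤ (F n).card := Nat.cast_nonneg _
  have h1 : (T.card : ℝ) ≤ ε / 2 * (F n).card := by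
    have : (0 : ℝ) ≤ T.card := Nat.cast_nonneg _
    nlinarith
  have h2 : (N : ℝ) ≤ ε / 2 * (F n).card := by nlinarith
  linarith

end Folner

/-! ### Alternating words -/

/-- A word is alternating if the letter `a` stands exactly at the odd positions, counted
from `0`. -/
def IsAlt (w : List Letter) : Prop := ∀ p (h : p < w.length), w[p] = .a ↔ Odd p

theorem IsAlt.reduced {w : List Letter} (h : IsAlt w) : Reduced w := by
  rw [Reduced, List.isChain_iff_getElem]
  intro p hp heq
  have h1 := h p (by omega)
  have h2 := h (p + 1) hp
  rw [heq, h2, Nat.odd_add_one] at h1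
  tauto

theorem IsAlt.append {v w : List Letter} (hv : IsAlt v) (hw : IsAlt w) (hev : Even v.length) :
    IsAlt (v ++ w) := by
  intro p hp
  rw [List.length_append] at hp
  by_cases h : p < v.length
  · rw [List.getElem_append_left h]
    exact hv p h
  · rw [List.getElem_append_right (by omega), hw]
    rw [Nat.odd_sub (by omega)]
    have := Nat.not_odd_iff_even.mpr hev
    tauto

theorem IsAlt.reverse {w : List Letter} (h : IsAlt w) (hodd : Odd w.length) : IsAlt w.reverse := by
  intro p hp
  have hp' : p < w.length := by simpa using hp
  rw [List.getElem_reverse, h]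
  obtain ⟨q, hq⟩ := hodd
  rw [hq, show 2 * q + 1 - 1 - p = 2 * q - p by omega, Nat.odd_sub (by omega)]
  have h1 : ¬ Odd (2 * q) := by simp
  have h2 := Nat.not_even_iff_odd (n := p)
  tauto

theorem IsAlt.head?_ne {w : List Letter} (h : IsAlt w) : w.head? ≠ some .a := by
  cases w with
  | nil => simp
  | cons i w =>
    intro hi
    have := (h 0 (by simp)).mp (by simpa using hi)
    simp at this

theorem IsAlt.getLast?_ne {w : List Letter} (h : IsAlt w) (hodd : Odd w.length) :
    w.getLast? ≠ some .a := by
  have := (h.reverse hodd).head?_ne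
  rwa [List.head?_reverse] at this

/-- Two alternating words with a fault between them, that is, with two adjacent letters other
than `a`: the place of the fault determines the first of the two words. -/
theorem eq_of_fault_prefix {v₁ w₁ v₂ w₂ : List Letter} (hv₁ : IsAlt v₁) (hw₁ : IsAlt w₁)
    (hv₂ : IsAlt v₂) (hw₂ : IsAlt w₂) (ho₁ : Odd v₁.length) (ho₂ : Odd v₂.length)
    (hne : w₁ ≠ []) (h : v₁ ++ w₁ <+: v₂ ++ w₂) : v₁ = v₂ := by
  have hpos : 0 < w₁.length := List.length_pos_iff.mpr hne
  have hlen := h.length_le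
  rw [List.length_append, List.length_append] at hlen
  have hget : ∀ p (hp : p < (v₁ ++ w₁).length), (v₁ ++ w₁)[p] =
      (v₂ ++ w₂)[p]'(lt_of_lt_of_le hp h.length_le) := fun p hp => h.getElem hp
  rcases lt_trichotomy v₁.length v₂.length with hlt | heq | hlt
  · exfalso
    have h1 := hget v₁.length (by simp; omega)
    rw [List.getElem_append_right le_rfl, List.getElem_append_left hlt,
      (hv₂ _ hlt).mpr ho₁, hw₁] at h1
    simp at h1
  · obtain ⟨t, ht⟩ := h
    rw [List.append_assoc] at ht
    exact (List.append_inj ht heq).1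
  · exfalso
    have h1 := hget v₂.length (by simp; omega)
    rw [List.getElem_append_left hlt, List.getElem_append_right le_rfl,
      (hv₁ _ hlt).mpr ho₂] at h1
    have h2 := (hw₂ _ _).mp h1.symm
    simp at h2

/-- The word `l, a, l, a, …` of length `n`. -/
def alt (l : Letter) (n : ℕ) : List Letter :=
  (List.range n).map fun p => if Even p then l else .a

@[simp] theorem length_alt (l : Letter) (n : ℕ) : (alt l n).length = n := by simp [alt]

theorem alt_succ (l : Letter) (n : ℕ) : alt l (n + 1) = alt l n ++ [if Even n then l else .a] := by
  simp [alt, List.range_succ]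

theorem isAlt_alt {l : Letter} (hl : l ≠ .a) (n : ℕ) : IsAlt (alt l n) := by
  intro p hp
  simp only [alt, List.getElem_map, List.getElem_range]
  split_ifs with h
  · simp [hl, h]
  · simpa using h

theorem head?_alt (l : Letter) {n : ℕ} (hn : 0 < n) : (alt l n).head? = some l := by
  obtain ⟨m, rfl⟩ := Nat.exists_eq_succ_of_ne_zero hn.ne'
  simp [alt, List.range_succ_eq_map]

theorem pathVertex_eq (x : Gam5) (l : Letter) (n : ℕ) :
    pathVertex x l n = wordProd (alt l n) * x := by
  induction n with
  | zero => simp [pathVertex, alt]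
  | succ n ih =>
    rw [alt_succ, wordProd_concat, mul_assoc, ← ih]
    exact T5.step_of_adj rfl

/-! ### The words of a code -/

theorem Code.ne_a (C : Code) (n : ℕ) : (C n : Letter) ≠ .a := by
  rcases (C n).2 with h | h <;> rw [h] <;> decide

theorem other_ne_a (l : Letter) : other l ≠ .a := by
  unfold other
  split_ifs <;> decide

theorem other_ne (l : Letter) : other l ≠ l := by
  unfold other
  split_ifs with h
  · rw [h]; decide
  · exact fun h1 => by cases l <;> simp_all

/-- The word of the path from the base vertex to `spine C n`. -/
def spineWord (C : Code) : ℕ → List Letter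
  | 0 => []
  | n + 1 => spineWord C n ++ alt (other (C n)) (2 ^ (n + 1))

/-- The word of the path from the base vertex to the nearer end of the `D`-edge number `n`. -/
def dWord (C : Code) (n : ℕ) : List Letter := spineWord C n ++ alt (C n) (2 ^ (n + 1) - 1)

/-- The end of the `D`-edge number `n` that is nearer to the base vertex. The other end is
`gen .a * dEnd C n`. -/
def dEnd (C : Code) (n : ℕ) : Gam5 := wordProd (dWord C n)

theorem spine_eq (C : Code) (n : ℕ) : spine C n = wordProd (spineWord C n) := by
  induction n with
  | zero => rfl
  | succ n ih => rw [spine, spineWord, pathVertex_eq, wordProd_append, ih]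

theorem length_spineWord (C : Code) (n : ℕ) : (spineWord C n).length + 2 = 2 ^ (n + 1) := by
  induction n with
  | zero => rfl
  | succ n ih =>
    rw [spineWord, List.length_append, length_alt]
    rw [pow_succ 2 (n + 1)]
    omega

theorem even_two_pow_succ (n : ℕ) : Even (2 ^ (n + 1)) := (even_two.pow_of_ne_zero n.succ_ne_zero)

theorem odd_two_pow_succ_sub_one (n : ℕ) : Odd (2 ^ (n + 1) - 1) := by
  rw [Nat.odd_sub Nat.one_le_two_pow]
  have := even_two_pow_succ n
  simp [this]

theorem even_length_spineWord (C : Code) (n : ℕ) : Even (spineWord C n).length := by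
  have h1 := length_spineWord C n
  have h2 := even_two_pow_succ n
  rw [← h1, Nat.even_add] at h2
  exact h2.mpr even_two

theorem length_dWord (C : Code) (n : ℕ) : (dWord C n).length + 3 = 2 ^ (n + 2) := by
  have := length_spineWord C n
  have h1 : 1 ≤ 2 ^ (n + 1) := Nat.one_le_two_pow
  rw [dWord, List.length_append, length_alt, pow_succ 2 (n + 1)]
  omega

theorem isAlt_spineWord (C : Code) (n : ℕ) : IsAlt (spineWord C n) := by
  induction n with
  | zero => intro p hp; simp [spineWord] at hp
  | succ n ih => exact ih.append (isAlt_alt (other_ne_a _) _) (even_length_spineWord C n)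

theorem isAlt_dWord (C : Code) (n : ℕ) : IsAlt (dWord C n) :=
  (isAlt_spineWord C n).append (isAlt_alt (C.ne_a n) _) (even_length_spineWord C n)

/-- The part of the path to the `D`-edge number `i` that lies beyond the branching point for an
earlier `D`-edge. -/
theorem exists_dWord_eq_append (C : Code) {i j : ℕ} (hij : j < i) :
    ∃ v, dWord C i = spineWord C j ++ v ∧ IsAlt v ∧ v.head? = some (other (C j)) ∧
      v.length + 2 ^ (j + 1) + 1 = 2 ^ (i + 2) := by
  obtain ⟨v, hv, hva⟩ : ∃ v, dWord C i = spineWord C (j + 1) ++ v ∧ IsAlt v := by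
    induction i, hij using Nat.le_induction with
    | base => exact ⟨_, rfl, isAlt_alt (C.ne_a _) _⟩
    | succ i hij ih =>
      have h1 : ∃ u, spineWord C i = spineWord C (j + 1) ++ u ∧ IsAlt u ∧ Even u.length := by
        clear ih
        induction i, hij using Nat.le_induction with
        | base => exact ⟨[], by simp, by intro p hp; simp at hp, by simp⟩
        | succ i hij ih =>
          obtain ⟨u, hu, hua, hue⟩ := ih
          refine ⟨u ++ alt (other (C i)) (2 ^ (i + 1)), ?_,
            hua.append (isAlt_alt (other_ne_a _) _) hue, ?_⟩
          · rw [spineWord, hu, List.append_assoc]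
          · rw [List.length_append, length_alt]
            exact hue.add (even_two_pow_succ i)
      obtain ⟨u, hu, hua, hue⟩ := h1
      refine ⟨u ++ (alt (other (C i)) (2 ^ (i + 1)) ++ alt (C (i + 1)) (2 ^ (i + 2) - 1)), ?_, ?_⟩
      · rw [dWord, spineWord, hu, List.append_assoc, List.append_assoc]
      · refine hua.append ?_ hue
        refine (isAlt_alt (other_ne_a _) _).append (isAlt_alt (C.ne_a _) _) ?_
        rw [length_alt]
        exact even_two_pow_succ i
  refine ⟨alt (other (C j)) (2 ^ (j + 1)) ++ v, ?_, ?_, ?_, ?_⟩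
  · rw [hv, spineWord, List.append_assoc]
  · refine (isAlt_alt (other_ne_a _) _).append hva ?_
    rw [length_alt]
    exact even_two_pow_succ j
  · rw [List.head?_append, head?_alt _ (by positivity), Option.some_or]
  · have h1 := length_dWord C i
    have h2 := length_spineWord C (j + 1)
    rw [hv, List.length_append] at h1
    rw [pow_succ 2 (j + 1)] at h2
    rw [List.length_append, length_alt]
    omega

/-- The path to a `D`-edge does not pass through another `D`-edge. -/
theorem eq_of_dWord_prefix (C : Code) {i j : ℕ} (h : dWord C j <+: dWord C i) : i = j := by
  rcases lt_trichotomy i j with hlt | heq | hlt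
  · have h1 := h.length_le
    have h2 := length_dWord C i
    have h3 := length_dWord C j
    have h4 : 2 ^ (i + 2) < 2 ^ (j + 2) := Nat.pow_lt_pow_right (by norm_num) (by omega)
    omega
  · exact heq
  · obtain ⟨v, hv, -, hhead, -⟩ := exists_dWord_eq_append C hlt
    rw [hv, dWord, List.prefix_append_right_inj] at h
    obtain ⟨t, rfl⟩ := h
    have h1 : 0 < 2 ^ (j + 1) - 1 := (odd_two_pow_succ_sub_one j).pos
    rw [List.head?_append, head?_alt _ h1, Option.some_or] at hhead
    exact absurd (Option.some.inj hhead).symm (other_ne _)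

/-- The path from a `D`-edge to a later one: it goes back to the branching point on the spine and
then along the spine, with two adjacent letters other than `a` at the branching point. -/
theorem exists_word_dEnd (C : Code) {i j : ℕ} (hij : j < i) : ∃ v, IsAlt v ∧ Odd v.length ∧
    v.length + 2 ^ (j + 1) + 1 = 2 ^ (i + 2) ∧
    Reduced ((alt (C j) (2 ^ (j + 1) - 1)).reverse ++ v) ∧
    wordProd ((alt (C j) (2 ^ (j + 1) - 1)).reverse ++ v) * dEnd C j = dEnd C i := by
  obtain ⟨v, hv, hva, hhead, hlen⟩ := exists_dWord_eq_append C hij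
  refine ⟨v, hva, ?_, hlen, ?_, ?_⟩
  · have h1 : Even (v.length + 2 ^ (j + 1) + 1) := hlen ▸ even_two_pow_succ (i + 1)
    rw [Nat.even_add_one, Nat.not_even_iff_odd, Nat.odd_add'] at h1
    by_contra hcon
    have h2 := even_two_pow_succ j
    rw [← Nat.not_odd_iff_even] at h2
    rw [Nat.not_odd_iff_even] at hcon
    tauto
  · refine List.IsChain.append (isAlt_alt (C.ne_a j) _).reduced.reverse hva.reduced ?_
    intro x hx y hy
    rw [List.getLast?_reverse, head?_alt _ (odd_two_pow_succ_sub_one j).pos] at hx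
    rw [hhead] at hy
    rw [← Option.some.inj hx, ← Option.some.inj hy]
    exact (other_ne _).symm
  · rw [dEnd, dEnd, dWord, hv, wordProd_append, wordProd_append, wordProd_append,
      wordProd_reverse, mul_assoc, inv_mul_cancel_left]

/-- The word that leads from one `D`-edge to another. It has a single fault, and the part before
the fault determines the first `D`-edge together with the letter of the code there. -/
theorem exists_connecting_word (C : Code) (i j : ℕ) :
    ∃ w, wordProd w * dEnd C i = dEnd C j ∧ Reduced w ∧ w.getLast? ≠ some .a ∧
      (w = [] ∨ ∃ u v, w = u ++ v ∧ IsAlt u ∧ IsAlt v ∧ Odd u.length ∧ v ≠ [] ∧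
        ∀ k l, l ≠ (C k : Letter) → u ≠ (alt l (2 ^ (k + 1) - 1)).reverse) := by
  have halt : ∀ j, IsAlt (alt (C j) (2 ^ (j + 1) - 1)) := fun j => isAlt_alt (C.ne_a j) _
  have hodd : ∀ j, Odd (alt (C j) (2 ^ (j + 1) - 1)).length := fun j => by
    rw [length_alt]; exact odd_two_pow_succ_sub_one j
  have hne : ∀ {w : List Letter}, Odd w.length → w ≠ [] := by
    rintro w hw rfl
    simp at hw
  rcases lt_trichotomy i j with hlt | rfl | hlt
  · obtain ⟨v, hva, hvo, hlen, hred, hprod⟩ := exists_word_dEnd C hlt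
    refine ⟨_, hprod, hred, ?_, Or.inr ⟨_, v, rfl, (halt i).reverse (hodd i), hva,
      by rw [List.length_reverse]; exact hodd i, hne hvo, ?_⟩⟩
    · rw [List.getLast?_append_of_ne_nil _ (hne hvo)]
      exact hva.getLast?_ne hvo
    · intro k l hl heq
      have h1 : alt (C i) (2 ^ (i + 1) - 1) = alt l (2 ^ (k + 1) - 1) := List.reverse_injective heq
      have h2 := congrArg List.length h1
      rw [length_alt, length_alt] at h2
      have h3 : 2 ^ (i + 1) = 2 ^ (k + 1) := by
        have h4 : 1 ≤ 2 ^ (i + 1) := Nat.one_le_two_pow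
        have h5 : 1 ≤ 2 ^ (k + 1) := Nat.one_le_two_pow
        omega
      obtain rfl : i = k := by
        have := Nat.pow_right_injective le_rfl h3
        omega
      have h4 := congrArg List.head? h1
      rw [head?_alt _ (odd_two_pow_succ_sub_one i).pos,
        head?_alt _ (odd_two_pow_succ_sub_one i).pos] at h4
      exact hl (Option.some.inj h4).symm
  · exact ⟨[], by simp, by simp, by simp, Or.inl rfl⟩
  · obtain ⟨v, hva, hvo, hlen, hred, hprod⟩ := exists_word_dEnd C hlt
    refine ⟨((alt (C j) (2 ^ (j + 1) - 1)).reverse ++ v).reverse, ?_, hred.reverse, ?_,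
      Or.inr ⟨v.reverse, alt (C j) (2 ^ (j + 1) - 1), by simp, hva.reverse hvo, halt j,
        by rw [List.length_reverse]; exact hvo, hne (hodd j), ?_⟩⟩
    · rw [wordProd_reverse, ← hprod, inv_mul_cancel_left]
    · rw [List.getLast?_reverse, List.head?_append_of_ne_nil _ (by simpa using hne (hodd j))]
      exact ((halt j).reverse (hodd j)).head?_ne
    · intro k l _ heq
      have h2 := congrArg List.length heq
      rw [List.length_reverse, List.length_reverse, length_alt] at h2
      have h4 : 1 ≤ 2 ^ (k + 1) := Nat.one_le_two_pow
      have h5 : 2 ^ (k + 1) + 2 ^ (j + 1) = 2 ^ (i + 2) := by omega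
      -- A sum of two powers of two is a power of two only if the two are equal.
      have h6 : 2 ^ (j + 2) ≤ 2 ^ (i + 1) := Nat.pow_le_pow_right (by norm_num) (by omega)
      have h7 : 2 ^ (j + 2) = 2 * 2 ^ (j + 1) := by ring
      have h8 : 2 ^ (i + 2) = 2 * 2 ^ (i + 1) := by ring
      have h9 : 0 < 2 ^ (j + 1) := by positivity
      have hk1 : 2 ^ (i + 1) < 2 ^ (k + 1) := by omega
      have hk2 : 2 ^ (k + 1) < 2 ^ (i + 2) := by omega
      have hk3 := (Nat.pow_lt_pow_iff_right (by norm_num)).mp hk1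
      have hk4 := (Nat.pow_lt_pow_iff_right (by norm_num)).mp hk2
      omega

/-! ### The action on the decorated tree -/

variable {C : Code}

/-- The vertices of the regular tree at which there is an edge of colour `D`. -/
def IsD (C : Code) (x : Gam5) : Prop := ∃ y, (treeT C).Adj none x y

theorem isD_iff {x : Gam5} : IsD C x ↔ ∃ n, x = dEnd C n ∨ x = gen .a * dEnd C n := by
  have h1 : ∀ n, pathVertex (spine C n) (C n) (2 ^ (n + 1) - 1) = dEnd C n := fun n => by
    rw [pathVertex_eq, spine_eq, ← wordProd_append]
    rfl
  have h2 : ∀ n, pathVertex (spine C n) (C n) (2 ^ (n + 1)) = gen .a * dEnd C n := fun n => by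
    have h3 : 2 ^ (n + 1) = (2 ^ (n + 1) - 1) + 1 := (Nat.sub_add_cancel Nat.one_le_two_pow).symm
    rw [h3, pathVertex, h1, if_neg (Nat.not_even_iff_odd.mpr (odd_two_pow_succ_sub_one n))]
    exact T5.step_of_adj rfl
  constructor
  · rintro ⟨y, hy, n, hn⟩
    rw [h1, h2, Sym2.eq_iff] at hn
    rcases hn with hn | hn
    · exact ⟨n, Or.inl hn.1⟩
    · exact ⟨n, Or.inr hn.1⟩
  · rintro ⟨n, rfl | rfl⟩
    · exact ⟨gen .a * dEnd C n, rfl, n, by rw [h1, h2]⟩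
    · exact ⟨dEnd C n, by change _ = _ * (_ * _); rw [← mul_assoc, gen_mul_self, one_mul], n,
        by rw [h1, h2, Sym2.eq_swap]⟩

theorem isD_dEnd (C : Code) (n : ℕ) : IsD C (dEnd C n) := isD_iff.mpr ⟨n, Or.inl rfl⟩

theorem IsD.gen_a_mul {x : Gam5} (h : IsD C x) : IsD C (gen .a * x) := by
  obtain ⟨n, rfl | rfl⟩ := isD_iff.mp h
  · exact isD_iff.mpr ⟨n, Or.inr rfl⟩
  · rw [← mul_assoc, gen_mul_self, one_mul]
    exact isD_dEnd C n

/-- A vertex of the regular tree as a vertex of the decorated tree. -/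
def base (C : Code) (x : Gam5) : VertS C := Sum.inl x

/-- The new vertex next to an end of a `D`-edge. -/
def mid {x : Gam5} (h : IsD C x) : VertS C := Sum.inr ⟨x, h⟩

theorem VertS.cases (v : VertS C) : (∃ x, v = base C x) ∨ ∃ x, ∃ h : IsD C x, v = mid h := by
  rcases v with x | ⟨x, h⟩
  · exact Or.inl ⟨x, rfl⟩
  · exact Or.inr ⟨x, h, rfl⟩

theorem base_injective : Function.Injective (base C) := Sum.inl_injective

theorem gen_smul (i : Letter) (v : VertS C) : gen i • v = (treeS C).step i v :=
  (treeS C).actionHom_gen i v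

theorem gen_smul_base {i : Letter} {x : Gam5} (h : i = .a → ¬ IsD C x) :
    gen i • base C x = base C (gen i * x) := by
  rw [gen_smul]
  refine (treeS C).step_of_adj (x := Sum.inl x) (y := Sum.inl (gen i * x)) ?_
  refine ⟨rfl, ?_⟩
  rintro ⟨rfl, hmem⟩
  exact h rfl ⟨gen .a * x, rfl, hmem⟩

theorem gen_a_smul_base {x : Gam5} (h : IsD C x) : gen .a • base C x = mid h := by
  rw [gen_smul]
  exact (treeS C).step_of_adj (x := Sum.inl x) (y := Sum.inr ⟨x, h⟩) ⟨rfl, rfl⟩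

theorem gen_a_smul_mid {x : Gam5} (h : IsD C x) : gen .a • mid h = base C x := by
  rw [← gen_a_smul_base h, ← mul_smul, gen_mul_self, one_smul]

theorem gen_b_smul_mid {x : Gam5} (h : IsD C x) : gen .b • mid h = mid h.gen_a_mul := by
  rw [gen_smul]
  refine (treeS C).step_of_adj (x := Sum.inr ⟨x, h⟩) (y := Sum.inr ⟨_, h.gen_a_mul⟩) ⟨rfl, ?_⟩
  obtain ⟨y, hy⟩ := h
  obtain rfl : y = gen .a * x := hy.1
  exact hy

theorem gen_smul_mid {i : Letter} (ha : i ≠ .a) (hb : i ≠ .b) {x : Gam5} (h : IsD C x) :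
    gen i • mid h = mid h := by
  rw [gen_smul]
  refine (treeS C).step_of_not (x := Sum.inr ⟨x, h⟩) ?_
  rintro ⟨y | y, hy⟩
  · exact ha hy.1
  · exact hb hy.1

/-- A walk in the decorated tree agrees with the walk in the regular tree as long as it
does not leave an end of a `D`-edge by the letter `a`. -/
theorem wordProd_smul_base {w : List Letter} {x : Gam5}
    (h : ∀ v, v ++ [.a] <+: w → ¬ IsD C (wordProd v * x)) :
    wordProd w • base C x = base C (wordProd w * x) := by
  induction w using List.reverseRecOn with
  | nil => simp
  | append_singleton w i ih =>
    rw [wordProd_concat, mul_smul, ih fun v hv => h v (hv.trans (List.prefix_append _ _)),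
      gen_smul_base, mul_assoc]
    rintro rfl
    exact h w (List.prefix_refl _)

/-- The path from the base vertex to a `D`-edge is the same in the decorated tree. -/
theorem dEnd_smul_base_one (C : Code) (n : ℕ) : dEnd C n • base C 1 = base C (dEnd C n) := by
  have h1 : wordProd (dWord C n) • base C 1 = base C (wordProd (dWord C n) * 1) := by
    refine wordProd_smul_base fun v hv hD => ?_
    rw [mul_one] at hD
    have hred := (isAlt_dWord C n).reduced.prefix hv
    have hvred := hred.prefix (List.prefix_append _ _)
    have hlen := hv.length_le
    rw [List.length_append, List.length_singleton] at hlen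
    obtain ⟨j, hj | hj⟩ := isD_iff.mp hD
    · have hvj := hvred.wordProd_inj (isAlt_dWord C j).reduced hj
      subst hvj
      have := eq_of_dWord_prefix C ((List.prefix_append _ _).trans hv)
      subst this
      omega
    · rw [dEnd, ← wordProd_concat] at hj
      have hvj := hvred.wordProd_inj ((isAlt_dWord C j).reduced.concat
        ((isAlt_dWord C j).getLast?_ne ?_)) hj
      · subst hvj
        have := eq_of_dWord_prefix C
          ((List.prefix_append _ _).trans ((List.prefix_append _ _).trans hv))
        subst this
        simp at hlen
      · rw [dWord, List.length_append, length_alt]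
        exact (even_length_spineWord C j).add_odd (odd_two_pow_succ_sub_one j)
  rwa [mul_one] at h1

/-- Consider an alternating word with one fault whose first part has the length of the one that
leads away from the `D`-edge number `k`, but starts with a letter other than `C k`. A walk in the
regular tree that starts at a `D`-edge and follows this word never meets a `D`-edge again. -/
theorem not_isD_of_prefix {k : ℕ} {l : Letter} (hla : l ≠ .a) (hl : l ≠ C k) {v w : List Letter}
    (hv : IsAlt v) (hred : Reduced ((alt l (2 ^ (k + 1) - 1)).reverse ++ v))
    (hw : w <+: (alt l (2 ^ (k + 1) - 1)).reverse ++ v) (hne : w ≠ []) {x : Gam5}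
    (hx : IsD C x) : ¬ IsD C (wordProd w * x) := by
  have hA : IsAlt (alt l (2 ^ (k + 1) - 1)).reverse :=
    (isAlt_alt hla _).reverse (by rw [length_alt]; exact odd_two_pow_succ_sub_one k)
  have hAodd : Odd (alt l (2 ^ (k + 1) - 1)).reverse.length := by
    rw [List.length_reverse, length_alt]; exact odd_two_pow_succ_sub_one k
  have hAne : (alt l (2 ^ (k + 1) - 1)).reverse ≠ [] := by
    intro h
    rw [h] at hAodd
    simp at hAodd
  have hwhead : w.head? ≠ some .a := by
    intro h
    obtain ⟨t, ht⟩ := hw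
    have h1 : (w ++ t).head? = some .a := by rw [List.head?_append_of_ne_nil _ hne, h]
    rw [ht, List.head?_append_of_ne_nil _ hAne] at h1
    exact hA.head?_ne h1
  have hwred := hred.prefix hw
  -- The two ends of an edge differ by an optional letter `a`.
  have hD : ∀ {y : Gam5}, IsD C y →
      ∃ (n : ℕ) (s : List Letter), (s = [] ∨ s = [.a]) ∧ y = wordProd s * dEnd C n := by
    intro y hy
    obtain ⟨n, rfl | rfl⟩ := isD_iff.mp hy
    · exact ⟨n, [], Or.inl rfl, by simp⟩
    · exact ⟨n, [.a], Or.inr rfl, by simp⟩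
  intro hy
  obtain ⟨i, s, hs, rfl⟩ := hD hx
  obtain ⟨j, t, ht, hj⟩ := hD hy
  obtain ⟨u, hu, hured, hulast, hform⟩ := exists_connecting_word C i j
  rw [← hu, ← mul_assoc, ← mul_assoc, mul_left_inj, ← wordProd_append, ← wordProd_append] at hj
  have hl1 : Reduced (s ++ w) := by
    rcases hs with rfl | rfl
    · simpa using hwred
    · refine List.IsChain.append (by simp) hwred ?_
      intro p hp q hq hpq
      simp only [List.getLast?_singleton, Option.mem_def, Option.some.injEq] at hp
      subst hp
      subst hpq
      exact hwhead hq
  have hl2 : Reduced (u ++ t) := by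
    rcases ht with rfl | rfl
    · simpa using hured
    · exact hured.concat hulast
  have heq := hl1.wordProd_inj hl2 hj
  rcases hform with rfl | ⟨A, B, rfl, hA', hB, hodd, hBne, hneq⟩
  · rw [List.nil_append] at heq
    rcases hs with rfl | rfl <;> rcases ht with rfl | rfl
    · exact hne heq
    · rw [List.nil_append] at heq
      rw [heq] at hwhead
      simp at hwhead
    · simp at heq
    · simp at heq
      exact hne heq
  · have hA'ne : A ≠ [] := by
      rintro rfl
      simp at hodd
    rcases hs with rfl | rfl
    · rw [List.nil_append] at heq
      refine hneq k l hl (eq_of_fault_prefix hA' hB hA hv hodd hAodd hBne ?_)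
      exact (heq ▸ List.prefix_append _ _ : A ++ B <+: w).trans hw
    · have h1 := congrArg List.head? heq
      rw [List.append_assoc, List.head?_append_of_ne_nil _ hA'ne] at h1
      exact hA'.head?_ne (by rw [← h1]; rfl)

/-! ### Separating subgroups -/

/-- If a finite set of vertices is invariant under the conjugates by `t` of the generators
`c`, `d`, `e`, then `t` moves it into the set of new vertices. On the other vertices these
generators act as on the free product, where they have no finite invariant sets. -/
theorem exists_smul_eq_mid {C : Code} {t : Gam5} {F : Finset (VertS C)}
    (hF : ∀ l : Letter, l = .c ∨ l = .d ∨ l = .e → ∀ v ∈ F, (t⁻¹ * gen l * t) • v ∈ F)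
    {v : VertS C} (hv : v ∈ F) : ∃ x, ∃ h : IsD C x, t • v = mid h := by
  classical
  rcases VertS.cases (t • v) with ⟨x, hx⟩ | hx
  swap
  · exact hx
  exfalso
  let E : Finset Gam5 := (F.image (t • ·)).preimage (base C) base_injective.injOn
  have hmem : ∀ {y}, y ∈ E ↔ ∃ u ∈ F, t • u = base C y := fun {y} => by
    rw [Finset.mem_preimage, Finset.mem_image]
  have hpos : 0 < E.card := Finset.card_pos.mpr ⟨x, hmem.mpr ⟨v, hv, hx⟩⟩
  refine not_almost_invariant E fun l hl => ?_
  have hsub : E.image (gen l * ·) ⊆ E := by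
    intro z hz
    obtain ⟨y, hy, rfl⟩ := Finset.mem_image.mp hz
    obtain ⟨u, hu, hty⟩ := hmem.mp hy
    refine hmem.mpr ⟨_, hF l hl u hu, ?_⟩
    rw [mul_assoc, mul_smul, smul_inv_smul, mul_smul, hty, gen_smul_base]
    rintro rfl
    simp at hl
  rw [Finset.union_eq_right.mpr hsub]
  omega

/-- A subgroup that contains the conjugates by some `t` of the generators `c`, `d`, `e` is not
amenable. -/
theorem not_amenableGroup_of_conj_mem {H : Subgroup Gam5} {t : Gam5}
    (hH : ∀ l : Letter, l = .c ∨ l = .d ∨ l = .e → t⁻¹ * gen l * t ∈ H) : ¬ AmenableGroup H := by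
  classical
  intro hA
  obtain ⟨F, hne, hF⟩ := AmenableAction.exists_sdiff hA
  obtain ⟨n, hc, hd, he⟩ := ((hF ⟨_, hH .c (by simp)⟩ (1 / 4) (by norm_num)).and
    ((hF ⟨_, hH .d (by simp)⟩ (1 / 4) (by norm_num)).and
      (hF ⟨_, hH .e (by simp)⟩ (1 / 4) (by norm_num)))).exists
  have hinj : Function.Injective fun h : H => t * (h : Gam5) := fun x y hxy =>
    Subtype.ext (mul_left_cancel hxy)
  have key : ∀ (l : Letter) (hl : t⁻¹ * gen l * t ∈ H),
      (((F n).image ((⟨_, hl⟩ : H) • ·) \ F n).card : ℝ) ≤ 1 / 4 * (F n).card →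
      3 * (((F n).image fun h : H => t * (h : Gam5)).image (gen l * ·) ∪
        (F n).image fun h : H => t * (h : Gam5)).card <
        4 * ((F n).image fun h : H => t * (h : Gam5)).card := by
    intro l hl hle
    have h1 : ((F n).image fun h : H => t * (h : Gam5)).image (gen l * ·) =
        ((F n).image ((⟨_, hl⟩ : H) • ·)).image fun h : H => t * (h : Gam5) := by
      rw [Finset.image_image, Finset.image_image]
      refine Finset.image_congr fun h _ => ?_
      change gen l * (t * (h : Gam5)) = t * (t⁻¹ * gen l * t * (h : Gam5))
      group
    rw [h1, ← Finset.image_union, Finset.card_image_of_injective _ hinj,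
      Finset.card_image_of_injective _ hinj, card_image_smul_union]
    have h2 : (0 : ℝ) < (F n).card := by exact_mod_cast (hne n).card_pos
    have h3 : (3 * ((((F n).image ((⟨_, hl⟩ : H) • ·) \ F n).card : ℝ) + (F n).card)) <
        4 * (F n).card := by linarith
    exact_mod_cast h3
  refine not_almost_invariant ((F n).image fun h : H => t * (h : Gam5)) ?_
  rintro l (rfl | rfl | rfl)
  · exact key _ _ hc
  · exact key _ _ hd
  · exact key _ _ he

/-- If the codes differ at `k`, then no vertex `v` of the second tree is a common starting point of
two paths to `D`-edges spelled by `dEnd C k` and `dEnd C (k + 1)`: the word that leads from the end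
of the first path to the end of the second meets a `D`-edge of `C'` only at its start. -/
theorem not_isD_of_code_ne {C C' : Code} {k : ℕ} (hk : C k ≠ C' k) (v : VertS C') {x y : Gam5}
    (hx : IsD C' x) (hy : IsD C' y) (hvx : dEnd C k • v = base C' x)
    (hvy : dEnd C (k + 1) • v = base C' y) : False := by
  obtain ⟨u, hu, -, -, hred, hprod⟩ := exists_word_dEnd C (Nat.lt_succ_self k)
  have hk' : (C k : Letter) ≠ C' k := fun h => hk (Subtype.ext h)
  have hodd := odd_two_pow_succ_sub_one k
  have hne : (alt (C k) (2 ^ (k + 1) - 1)).reverse ≠ [] := by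
    intro h
    have := congrArg List.length h
    rw [List.length_reverse, length_alt] at this
    rw [this] at hodd
    simp at hodd
  have hmove : wordProd ((alt (C k) (2 ^ (k + 1) - 1)).reverse ++ u) • base C' x =
      base C' (wordProd ((alt (C k) (2 ^ (k + 1) - 1)).reverse ++ u) * x) := by
    refine wordProd_smul_base fun w hw => ?_
    refine not_isD_of_prefix (C.ne_a k) hk' hu hred ((List.prefix_append _ _).trans hw) ?_ hx
    rintro rfl
    obtain ⟨t, ht⟩ := hw
    have h1 := congrArg List.head? ht
    rw [List.head?_append_of_ne_nil _ hne] at h1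
    refine IsAlt.head?_ne ((isAlt_alt (C.ne_a k) _).reverse ?_) h1.symm
    rw [length_alt]
    exact hodd
  rw [← hprod, mul_smul, hvx, hmove] at hvy
  refine not_isD_of_prefix (C.ne_a k) hk' hu hred (List.prefix_refl _) ?_ hx
    ((base_injective hvy).symm ▸ hy)
  simp [hne]

theorem exists_isSeparating {C C' : Code} (hCC' : C ≠ C') :
    ∃ H : Subgroup Gam5, IsSeparating C C' H := by
  obtain ⟨k, hk⟩ := Function.ne_iff.mp hCC'
  let t : ℕ → Gam5 := fun n => gen .a * dEnd C n
  let S : Set Gam5 := (fun q : ℕ × Letter => (t q.1)⁻¹ * gen q.2 * t q.1) ''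
    (({k, k + 1} : Set ℕ) ×ˢ ({.c, .d, .e} : Set Letter))
  have hS : ∀ n, n = k ∨ n = k + 1 → ∀ l : Letter, l = .c ∨ l = .d ∨ l = .e →
      (t n)⁻¹ * gen l * t n ∈ Subgroup.closure S := fun n hn l hl =>
    Subgroup.subset_closure ⟨(n, l), ⟨hn, hl⟩, rfl⟩
  refine ⟨Subgroup.closure S, ?_, ?_, ?_, ?_⟩
  · rw [Subgroup.closure_le]
    rintro _ ⟨⟨n, l⟩, ⟨-, hl⟩, rfl⟩
    have ht : t n • base C 1 = mid (isD_dEnd C n) := by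
      rw [mul_smul, dEnd_smul_base_one, gen_a_smul_base]
    change ((t n)⁻¹ * gen l * t n) • base C 1 = base C 1
    rw [mul_smul, mul_smul, inv_smul_eq_iff, ht, gen_smul_mid]
    · rintro rfl; simp at hl
    · rintro rfl; simp at hl
  · refine (Subgroup.fg_iff _).mpr ⟨S, rfl, Set.Finite.image _ ?_⟩
    exact (Set.toFinite _).prod (Set.toFinite _)
  · exact not_amenableGroup_of_conj_mem (hS k (Or.inl rfl))
  · rintro F ⟨v, hv⟩ hF
    have h1 : ∀ n, n = k ∨ n = k + 1 → ∃ x, IsD C' x ∧ dEnd C n • v = base C' x := by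
      intro n hn
      obtain ⟨x, hx, htx⟩ := exists_smul_eq_mid (t := t n)
        (fun l hl u hu => hF _ (hS n hn l hl) u hu) hv
      refine ⟨x, hx, ?_⟩
      rw [← gen_a_smul_mid hx, ← htx, ← mul_smul, ← mul_assoc, gen_mul_self, one_mul]
    obtain ⟨x, hx, hvx⟩ := h1 k (Or.inl rfl)
    obtain ⟨y, hy, hvy⟩ := h1 (k + 1) (Or.inr rfl)
    exact not_isD_of_code_ne hk v hx hy hvx hvy

/-! ### Comparison with the action on the free product -/

variable {C : Code}

/-- The word length on the vertices of the decorated tree, where a new vertex has the length of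
the end of a `D`-edge next to it. -/
noncomputable def height (v : VertS C) : ℕ :=
  Sum.elim (fun x => (red x).length) (fun y => (red y.1).length) v

theorem height_base (x : Gam5) : height (base C x) = (red x).length := rfl

theorem height_mid {x : Gam5} (h : IsD C x) : height (mid h) = (red x).length := rfl

theorem height_gen_smul_le (i : Letter) (v : VertS C) : height (gen i • v) ≤ height v + 1 := by
  rcases VertS.cases v with ⟨x, rfl⟩ | ⟨x, h, rfl⟩
  · by_cases hD : i = .a → ¬ IsD C x
    · rw [gen_smul_base hD, height_base, height_base]
      exact length_red_gen_mul_le i x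
    · push Not at hD
      obtain ⟨rfl, hD⟩ := hD
      rw [gen_a_smul_base hD, height_base, height_mid]
      omega
  · by_cases ha : i = .a
    · subst ha
      rw [gen_a_smul_mid, height_base, height_mid]
      omega
    · by_cases hb : i = .b
      · subst hb
        rw [gen_b_smul_mid, height_mid, height_mid]
        exact length_red_gen_mul_le _ _
      · rw [gen_smul_mid ha hb]
        omega

theorem exists_height_smul_le (g : Gam5) :
    ∃ K : ℕ, ∀ v : VertS C, height (g • v) ≤ height v + K := by
  induction g using gam5_induction with
  | one => exact ⟨0, fun v => by simp⟩
  | gen_mul i g ih =>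
    obtain ⟨K, hK⟩ := ih
    refine ⟨K + 1, fun v => ?_⟩
    rw [mul_smul]
    have h1 := height_gen_smul_le i (g • v)
    have h2 := hK v
    omega

theorem height_dEnd (n : ℕ) : height (base C (dEnd C n)) + 3 = 2 ^ (n + 2) := by
  rw [height_base, dEnd, (isAlt_dWord C n).reduced.red_wordProd, length_dWord]

/-- The distances between the `D`-edges tend to infinity, so a fixed group element maps only
finitely many of their ends to ends of others. -/
theorem eventually_smul_dEnd_ne (g : Gam5) : ∃ N, ∀ m ≥ N, ∀ n ≥ N, m ≠ n →
    g • base C (dEnd C m) ≠ base C (dEnd C n) := by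
  have key : ∀ g : Gam5, ∃ N, ∀ m ≥ N, ∀ n > m,
      g • base C (dEnd C m) ≠ base C (dEnd C n) := by
    intro g
    obtain ⟨K, hK⟩ := exists_height_smul_le (C := C) g
    refine ⟨K, fun m hm n hn heq => ?_⟩
    have h1 := hK (base C (dEnd C m))
    rw [heq] at h1
    have h2 := height_dEnd (C := C) m
    have h3 := height_dEnd (C := C) n
    have h4 : 2 ^ (m + 3) ≤ 2 ^ (n + 2) := Nat.pow_le_pow_right (by norm_num) (by omega)
    have h5 : 2 ^ (m + 3) = 2 * 2 ^ (m + 2) := by ring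
    have h6 : m + 2 < 2 ^ (m + 2) := Nat.lt_two_pow_self
    omega
  obtain ⟨N₁, h₁⟩ := key g
  obtain ⟨N₂, h₂⟩ := key g⁻¹
  refine ⟨max N₁ N₂, fun m hm n hn hmn heq => ?_⟩
  rcases Nat.lt_or_gt_of_ne hmn with h | h
  · exact h₁ m (le_of_max_le_left hm) n h heq
  · exact h₂ n (le_of_max_le_right hn) m h (by rw [← heq, inv_smul_smul])

/-- The set is covered by finitely many translates of the sequence of the nearer ends of the
`D`-edges, that is, it lies within a bounded distance from the `D`-edges. -/
def NearD (A : Set (VertS C)) : Prop :=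
  ∃ W : Finset Gam5, A ⊆ ⋃ w ∈ W, Set.range fun n => w • base C (dEnd C n)

theorem NearD.mono {A B : Set (VertS C)} (hB : NearD B) (h : A ⊆ B) : NearD A := by
  obtain ⟨W, hW⟩ := hB
  exact ⟨W, h.trans hW⟩

theorem NearD.union {A B : Set (VertS C)} (hA : NearD A) (hB : NearD B) : NearD (A ∪ B) := by
  classical
  obtain ⟨V, hV⟩ := hA
  obtain ⟨W, hW⟩ := hB
  refine ⟨V ∪ W, Set.union_subset (hV.trans ?_) (hW.trans ?_)⟩
  · exact Set.biUnion_subset_biUnion_left fun x hx => Finset.mem_union_left _ hx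
  · exact Set.biUnion_subset_biUnion_left fun x hx => Finset.mem_union_right _ hx

theorem NearD.preimage {A : Set (VertS C)} (hA : NearD A) (g : Gam5) :
    NearD {v : VertS C | g • v ∈ A} := by
  classical
  obtain ⟨W, hW⟩ := hA
  refine ⟨W.image (g⁻¹ * ·), fun v hv => ?_⟩
  obtain ⟨w, hw, n, hn⟩ := Set.mem_iUnion₂.mp (hW hv)
  refine Set.mem_iUnion₂.mpr ⟨g⁻¹ * w, Finset.mem_image_of_mem _ hw, n, ?_⟩
  change (g⁻¹ * w) • _ = v
  rw [mul_smul, inv_smul_eq_iff]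
  exact hn

theorem nearD_ends : NearD {v : VertS C | ∃ x, IsD C x ∧ v = base C x} := by
  classical
  refine ⟨{1, gen .a * gen .b * gen .a}, ?_⟩
  rintro v ⟨x, hx, rfl⟩
  obtain ⟨n, rfl | rfl⟩ := isD_iff.mp hx
  · exact Set.mem_iUnion₂.mpr ⟨1, by simp, n, one_smul _ _⟩
  · refine Set.mem_iUnion₂.mpr ⟨gen .a * gen .b * gen .a, by simp, n, ?_⟩
    change (gen .a * gen .b * gen .a) • _ = _
    rw [mul_smul, mul_smul, gen_a_smul_base (isD_dEnd C n), gen_b_smul_mid, gen_a_smul_mid]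

theorem nearD_mid : NearD {v : VertS C | ∃ x, ∃ h : IsD C x, v = mid h} := by
  refine (nearD_ends.preimage (gen .a)).mono ?_
  rintro v ⟨x, h, rfl⟩
  exact ⟨x, h, gen_a_smul_mid h⟩

/-- Away from the `D`-edges a group element acts on the decorated tree as by
left multiplication. -/
theorem nearD_smul_ne (g : Gam5) :
    NearD {v : VertS C | ¬ ∃ x, v = base C x ∧ g • v = base C (g * x)} := by
  induction g using gam5_induction with
  | one =>
    refine nearD_mid.mono fun v hv => ?_
    rcases VertS.cases v with ⟨x, rfl⟩ | h
    · exact absurd ⟨x, rfl, by simp⟩ hv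
    · exact h
  | gen_mul i g ih =>
    refine (ih.union (nearD_ends.preimage g)).mono fun v hv => ?_
    by_contra hcon
    rw [Set.mem_union, not_or] at hcon
    obtain ⟨h1, h2⟩ := hcon
    obtain ⟨x, rfl, hx⟩ := not_not.mp h1
    refine hv ⟨x, rfl, ?_⟩
    rw [mul_smul, hx, gen_smul_base, mul_assoc]
    rintro - hD
    exact h2 ⟨g * x, hD, hx⟩

/-- If a finitely generated subgroup has no finite non-empty invariant set of vertices and acts
amenably, then a Følner sequence has density zero near the `D`-edges, so that it is
essentially a Følner sequence for the free action on the free product. -/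
theorem amenableGroup_of_amenableAction {H : Subgroup Gam5} (hfg : H.FG)
    (hinv : ∀ F : Finset (VertS C), F.Nonempty → ¬ ∀ h ∈ H, ∀ v ∈ F, h • v ∈ F)
    (hA : AmenableAction H (VertS C)) : AmenableGroup H := by
  classical
  obtain ⟨F, hne, hF⟩ := hA.exists_sdiff
  have hB := exists_finset_card_image_smul (G := H) (X := VertS C)
    ((Group.fg_iff_subgroup_fg H).mpr hfg)
    (fun E hE h => hinv E hE fun g hg v hv => h ⟨g, hg⟩ v hv)
  have hnull : ∀ {A : Set (VertS C)}, NearD A → ∀ {ε : ℝ}, 0 < ε →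
      ∀ᶠ n in atTop, (((F n).filter (· ∈ A)).card : ℝ) ≤ ε * (F n).card := by
    rintro A ⟨W, hW⟩ ε hε
    have h1 : ∀ᶠ n in atTop, ∀ w ∈ W,
        (((F n).filter (· ∈ Set.range fun m => w • base C (dEnd C m))).card : ℝ) ≤
          ε / (W.card + 1) * (F n).card := by
      refine (Finset.eventually_all W).mpr fun w _ => ?_
      refine eventually_card_filter_range_le hne hF hB (fun g => ?_) (by positivity)
      obtain ⟨N, hN⟩ := eventually_smul_dEnd_ne (C := C) (w⁻¹ * g * w)
      refine ⟨N, fun m hm n hn hmn heq => hN m hm n hn hmn ?_⟩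
      rw [mul_smul, mul_smul, inv_smul_eq_iff]
      exact heq
    filter_upwards [h1] with n hn
    have h2 : (F n).filter (· ∈ A) ⊆
        W.biUnion fun w => (F n).filter (· ∈ Set.range fun m => w • base C (dEnd C m)) := by
      intro v hv
      obtain ⟨hv1, hv2⟩ := Finset.mem_filter.mp hv
      obtain ⟨w, hw, hvw⟩ := Set.mem_iUnion₂.mp (hW hv2)
      exact Finset.mem_biUnion.mpr ⟨w, hw, Finset.mem_filter.mpr ⟨hv1, hvw⟩⟩
    have h3 : (((F n).filter (· ∈ A)).card : ℝ) ≤ ∑ w ∈ W,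
        (((F n).filter (· ∈ Set.range fun m => w • base C (dEnd C m))).card : ℝ) := by
      exact_mod_cast (Finset.card_le_card h2).trans Finset.card_biUnion_le
    refine h3.trans ((Finset.sum_le_sum hn).trans ?_)
    rw [Finset.sum_const, nsmul_eq_mul, ← mul_assoc]
    refine mul_le_mul_of_nonneg_right ?_ (Nat.cast_nonneg _)
    rw [← mul_div_assoc, div_le_iff₀ (by positivity)]
    nlinarith
  let E : ℕ → Finset Gam5 := fun n => (F n).preimage (base C) base_injective.injOn
  have hmemE : ∀ {n x}, x ∈ E n ↔ base C x ∈ F n := Finset.mem_preimage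
  have hE : ∀ᶠ n in atTop, ((F n).card : ℝ) ≤ 2 * (E n).card := by
    filter_upwards [hnull nearD_mid (ε := 1 / 2) (by norm_num)] with n hn
    have h1 : F n ⊆ (E n).image (base C) ∪
        (F n).filter (· ∈ {v : VertS C | ∃ x, ∃ h : IsD C x, v = mid h}) := by
      intro v hv
      rcases VertS.cases v with ⟨x, rfl⟩ | h
      · exact Finset.mem_union_left _ (Finset.mem_image_of_mem _ (hmemE.mpr hv))
      · exact Finset.mem_union_right _ (Finset.mem_filter.mpr ⟨hv, h⟩)
    have h2 := (Finset.card_le_card h1).trans (Finset.card_union_le _ _)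
    rw [Finset.card_image_of_injective _ base_injective] at h2
    have h3 : ((F n).card : ℝ) ≤ (E n).card +
        ((F n).filter (· ∈ {v : VertS C | ∃ x, ∃ h : IsD C x, v = mid h})).card := by
      exact_mod_cast h2
    have h4 := h3.trans (add_le_add le_rfl hn)
    linarith
  have hEinv : ∀ (g : H) (ε : ℝ), 0 < ε →
      ∀ᶠ n in atTop, (((E n).image (g • ·) \ E n).card : ℝ) ≤ ε * (E n).card := by
    intro g ε hε
    filter_upwards [hE, hF g (ε / 4) (by positivity),
      hnull (nearD_smul_ne (C := C) (g : Gam5)) (ε := ε / 4) (by positivity)] with n hn hn1 hn2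
    have hinj : Function.Injective fun x : Gam5 => base C ((g : Gam5)⁻¹ * x) := fun x y hxy =>
      mul_left_cancel (base_injective hxy)
    let P := (F n).filter
      (· ∈ {v : VertS C | ¬ ∃ x, v = base C x ∧ (g : Gam5) • v = base C (g * x)})
    have h1 : (E n).image (g • ·) \ E n ⊆
        (P.preimage (fun x : Gam5 => base C ((g : Gam5)⁻¹ * x)) hinj.injOn) ∪
        ((F n).image (g • ·) \ F n).preimage (base C) base_injective.injOn := by
      intro y hy
      obtain ⟨hy1, hy2⟩ := Finset.mem_sdiff.mp hy
      obtain ⟨x, hx, rfl⟩ := Finset.mem_image.mp hy1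
      rw [hmemE] at hx hy2
      by_cases hgood : ∃ z, base C x = base C z ∧ (g : Gam5) • base C x = base C (g * z)
      · obtain ⟨z, hz, hgz⟩ := hgood
        obtain rfl := base_injective hz
        refine Finset.mem_union_right _ (Finset.mem_preimage.mpr (Finset.mem_sdiff.mpr ⟨?_, hy2⟩))
        exact Finset.mem_image.mpr ⟨base C x, hx, hgz⟩
      · refine Finset.mem_union_left _ (Finset.mem_preimage.mpr ?_)
        have h2 : (g : Gam5)⁻¹ * (g • x) = x := inv_mul_cancel_left (g : Gam5) x
        rw [h2]
        exact Finset.mem_filter.mpr ⟨hx, hgood⟩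
    have h2 := (Finset.card_le_card h1).trans (Finset.card_union_le _ _)
    rw [Finset.card_preimage, Finset.card_preimage] at h2
    have h5 : (((E n).image (g • ·) \ E n).card : ℝ) ≤
        P.card + ((F n).image (g • ·) \ F n).card := by
      exact_mod_cast h2.trans (Nat.add_le_add (Finset.card_filter_le _ _) (Finset.card_filter_le _ _))
    have h6 : (P.card : ℝ) ≤ ε / 4 * (F n).card := by convert hn2
    nlinarith
  have hfree : AmenableAction H Gam5 := by
    refine amenableAction_of_finite fun S ε hε => ?_
    have h1 : ∀ᶠ n in atTop, ∀ g ∈ S,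
        (((E n).image (g • ·) \ E n).card : ℝ) ≤ ε * (E n).card :=
      (Finset.eventually_all S).mpr fun g _ => hEinv g ε hε
    obtain ⟨n, hn1, hn2⟩ := (hE.and h1).exists
    refine ⟨E n, Finset.card_pos.mp ?_, hn2⟩
    have h2 : (0 : ℝ) < (F n).card := by exact_mod_cast (hne n).card_pos
    have h3 : (0 : ℝ) < (E n).card := by linarith
    exact_mod_cast h3
  refine hfree.amenableGroup_of_free fun g x hgx => ?_
  exact Subtype.ext (mul_eq_right.mp (show (g : Gam5) * x = x from hgx))

end CodeTree

theorem mainTheorem7 (C C' : CodeTree.Code) (hCC' : C ≠ C') :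
    (∃ H : Subgroup CodeTree.Gam5, CodeTree.IsSeparating C C' H) ∧
    ∀ H : Subgroup CodeTree.Gam5, CodeTree.IsSeparating C C' H →
      ¬ CodeTree.AmenableAction H (CodeTree.VertS C') :=
  ⟨CodeTree.exists_isSeparating hCC', fun _ hH hA =>
    hH.not_amenable (CodeTree.amenableGroup_of_amenableAction hH.fg hH.no_invariant hA)⟩
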